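/- Let $d\ge 1$ be an integer and $\alpha\in(0,1)$. For $0<\beta<d$ let $$I_\beta f(x)=\frac1{\gamma(\beta)}\int_{\mathbb R^d}\frac{f(y)}{|x-y|^{d-\beta}}\,dy,\qquad \gamma(\beta)=\frac{\pi^{d/2}2^\beta\,\Gamma(\beta/2)}{\Gamma((d-\beta)/2)},$$ be the Riesz potential. For $u\in L^q(\mathbb R^d)$ with $1\le q<d/(1-\alpha)$, the fractional gradient $D^\alpha u=\nabla I_{1-\alpha}u$ is defined distributionally by $$\langle D^\alpha u,\Phi\rangle=-\int_{\mathbb R^d}I_{1-\alpha}u\,\operatorname{div}\Phi\,dx\qquad(\Phi\in C_c^\infty(\mathbb R^d;\mathbb R^d)).$$ Fix any $q$ with $1\le q<d/(1-\alpha)$. (i) For every $C'>0$, there is no constant $C<\infty$ such that $$\int_{\mathbb R^d}|u|\,d\mu\le C\int_{\mathbb R^d}|D^\alpha u|\,dx$$ for all continuous $u\in L^q(\mathbb R^d)$ with $D^\alpha u\in L^1(\mathbb R^d;\mathbb R^d)$ and all non-negative Radon measures $\mu$ on $\mathbb R^d$ satisfying $\mu(B(x,r))\le C'r^{d-\alpha}$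 for all $x\in\mathbb R^d$ and $r>0$. (In particular, there is no such constant valid simultaneously for all $q\in[1,d/(1-\alpha))$.) (ii) For $s>0$, let $\mathcal H^{s}_\infty$ be the Hausdorff content, defined for compact $K\subset\mathbb R^d$ by $$\mathcal H^{s}_\infty(K)=\inf\Bigl\{\sum_{i=0}^\infty\omega_{s}\,r_i^{s}:\ K\subset\bigcup_{i=0}^\infty B(x_i,r_i)\Bigr\},\qquad \omega_s=\frac{\pi^{s/2}}{\Gamma(s/2+1)},$$ for open $U$ by $\mathcal H^s_\infty(U)=\sup\{\mathcal H^s_\infty(K): K\subset U\text{ compact}\}$, and for arbitrary $A$ by $\mathcal H^s_\infty(A)=\inf\{\mathcal H^s_\infty(U): U\supset A\text{ open}\}$. There is no constant $C<\infty$ such that $$\int_0^\infty\mathcal H^{d-\alpha}_\infty(\{|u|>t\})\,dt\le C\int_{\mathbb R^d}|D^\alpha u|\,dx$$ for all continuous $u\in L^q(\mathbb R^d)$ with $D^\alpha u\in L^1(\mathbb R^d;\mathbb R^d)$. -/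

import Mathlib

open MeasureTheory Set
open scoped ENNReal NNReal ContDiff

noncomputable section

/-- The normalizing constant `γ(β) = π^{d/2} 2^β Γ(β/2) / Γ((d-β)/2)` of the Riesz potential of
order `β` on `ℝ^d`. -/
def rieszGamma (d : ℕ) (β : ℝ) : ℝ :=
  Real.pi ^ ((d : ℝ) / 2) * 2 ^ β * Real.Gamma (β / 2) / Real.Gamma ((d : ℝ) / 2 - β / 2)

/-- The Riesz potential `I_β f (x) = γ(β)⁻¹ ∫ f(y) / |x - y|^{d-β} dy` on `ℝ^d`. -/
def rieszPotential {d : ℕ} (β : ℝ) (f : EuclideanSpace ℝ (Fin d) → ℝ)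
    (x : EuclideanSpace ℝ (Fin d)) : ℝ :=
  (1 / rieszGamma d β) * ∫ y, f y / ‖x - y‖ ^ ((d : ℝ) - β)

/-- The divergence of a vector field on `ℝ^d`. -/
def divergence {d : ℕ} (Φ : EuclideanSpace ℝ (Fin d) → EuclideanSpace ℝ (Fin d))
    (x : EuclideanSpace ℝ (Fin d)) : ℝ :=
  ∑ i : Fin d, fderiv ℝ Φ x (EuclideanSpace.single i 1) i

/-- The locally integrable vector field `G` is the distributional fractional gradient
`D^α u = ∇ I_{1-α} u`, i.e. `∫ G · Φ = - ∫ (I_{1-α} u) div Φ` for all test fields `Φ`. -/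
def IsFractionalGradient {d : ℕ} (α : ℝ) (u : EuclideanSpace ℝ (Fin d) → ℝ)
    (G : EuclideanSpace ℝ (Fin d) → EuclideanSpace ℝ (Fin d)) : Prop :=
  LocallyIntegrable G volume ∧
  ∀ Φ : EuclideanSpace ℝ (Fin d) → EuclideanSpace ℝ (Fin d),
    ContDiff ℝ ∞ Φ → HasCompactSupport Φ →
      ∫ x, inner ℝ (G x) (Φ x) = - ∫ x, rieszPotential (1 - α) u x * divergence Φ x

/-- The Hausdorff content of dimension `s` of a compact set `K`: the infimum of
`∑ ω_s r_i^s` over countable coverings of `K` by balls `B(x_i, r_i)`, where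
`ω_s = π^{s/2} / Γ(s/2 + 1)` (balls of radius `0`, which are empty, allow finite coverings). -/
def compactHausdorffContent {d : ℕ} (s : ℝ) (K : Set (EuclideanSpace ℝ (Fin d))) : ℝ≥0∞ :=
  ⨅ (x : ℕ → EuclideanSpace ℝ (Fin d)) (r : ℕ → ℝ≥0) (_ : K ⊆ ⋃ i, Metric.ball (x i) (r i)),
    ∑' i, ENNReal.ofReal (Real.pi ^ (s / 2) / Real.Gamma (s / 2 + 1) * (r i : ℝ) ^ s)

/-- The Hausdorff content of dimension `s` of an arbitrary set, obtained from its values on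
compact sets by regularity: from inside for open sets, then from outside for all sets. -/
def hausdorffContent {d : ℕ} (s : ℝ) (A : Set (EuclideanSpace ℝ (Fin d))) : ℝ≥0∞ :=
  ⨅ (U : Set (EuclideanSpace ℝ (Fin d))) (_ : IsOpen U) (_ : A ⊆ U),
    ⨆ (K : Set (EuclideanSpace ℝ (Fin d))) (_ : IsCompact K) (_ : K ⊆ U),
      compactHausdorffContent s K

end

/-!
The proof rests on one explicit family of functions. Put `s = 1 - α`, let `p_t` be the heat kernel
of `ℝ^d`, `P_t` the heat semigroup, and let `v(x) = V(x₀) K(x₁, …, x_{d-1})`, where `K` is a fixed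
bump function of integral one and `V` is an odd one-dimensional profile which jumps across `0`,
smoothed at the scale `√ε` (`jumpProfile`). Since `V' = p_ε - p_1`, the functions `v` are bounded in
`W^{1,1}` uniformly in `ε`. The counterexample is a mollified fractional Laplacian of `v`,
`u = ε⁻¹ ∫₀^∞ t^{-s/2} (P_t v - P_{t+ε} v) dt` (`smoothedFracLaplacian`). It is continuous, bounded and
integrable, hence lies in every `L^q`.

* Upper bound. The Riesz kernel of order `s` is a superposition of the heat kernels with weight
  `t^{s/2-1}`. By the semigroup law and a telescoping argument, `I_s u` is a constant multiple of the
  time average `ε⁻¹ ∫₀^ε P_r v dr` (`rieszPotential_smoothedFracLaplacian`), the constant being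
  independent of `ε`. Hence `D^α u` is the same multiple of the average of `P_r ∇v`, and its
  `L¹`-norm stays bounded as `ε → 0`.
* Lower bound. Near the hyperplane `x₀ = 0` the limit of `u` behaves like `sgn(x₀) |x₀|^{-(1-α)}`,
  while the measure `|x₀|^{-α} dx` gives a ball of radius `r` a mass of at most a constant times
  `r^{d-α}` (`hyperplaneMeasure_ball_le`). The pairing of the two diverges logarithmically. It is
  computed exactly: the pairing of `P_t v` with `sgn(x₀) |x₀|^{-α}` reduces to the moments of the
  one-dimensional heat kernel (`integral_oddPower_mul_heatFlow`), and integration in `t` yields the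
  lower bound `c log (1 / ε) - C` (`log_le_integral_oddPower_mul`).

This gives (i). Part (ii) follows from the same measure, because a measure with growth
`μ(B(x, r)) ≤ C r^{d-α}` is dominated by the Hausdorff content of dimension `d - α`
(`mul_measure_le_hausdorffContent`), so that the layer-cake formula reduces it to (i).
-/

set_option linter.unusedSectionVars false

/-! ### The heat kernel -/

section HeatKernel

variable {E : Type*} [NormedAddCommGroup E] [InnerProductSpace ℝ E] [FiniteDimensional ℝ E]
  [MeasurableSpace E] [BorelSpace E]

/-- The Gauss–Weierstrass kernel `(4πt)^{-d/2} exp(-‖x‖² / 4t)` of a `d`-dimensional Euclidean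
space. Only times `t > 0` are meaningful. -/
noncomputable def heatKernel (t : ℝ) (x : E) : ℝ :=
  (4 * Real.pi * t) ^ (-((Module.finrank ℝ E : ℝ) / 2)) * Real.exp (-(‖x‖ ^ 2 / (4 * t)))

theorem heatKernel_pos {t : ℝ} (ht : 0 < t) (x : E) : 0 < heatKernel t x := by
  unfold heatKernel; positivity

theorem heatKernel_neg (t : ℝ) (x : E) : heatKernel t (-x) = heatKernel t x := by
  simp [heatKernel]

theorem heatKernel_le {t : ℝ} (ht : 0 < t) (x : E) :
    heatKernel t x ≤ (4 * Real.pi * t) ^ (-((Module.finrank ℝ E : ℝ) / 2)) := by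
  unfold heatKernel
  refine mul_le_of_le_one_right (by positivity) (Real.exp_le_one_iff.2 ?_)
  have : 0 ≤ ‖x‖ ^ 2 / (4 * t) := by positivity
  linarith

theorem continuous_heatKernel (t : ℝ) : Continuous (heatKernel t : E → ℝ) := by
  unfold heatKernel; fun_prop

theorem measurable_heatKernel_uncurry :
    Measurable fun p : ℝ × E => heatKernel p.1 p.2 := by
  unfold heatKernel; fun_prop

theorem integral_heatKernel {t : ℝ} (ht : 0 < t) : ∫ x : E, heatKernel t x = 1 := by
  have h : ∀ x : E, heatKernel t x = (4 * Real.pi * t) ^ (-((Module.finrank ℝ E : ℝ) / 2)) *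
      Real.exp (-(1 / (4 * t)) * ‖x‖ ^ 2) := by
    intro x; unfold heatKernel; congr 2; ring
  simp_rw [h]
  rw [integral_const_mul, GaussianFourier.integral_rexp_neg_mul_sq_norm (by positivity),
    show Real.pi / (1 / (4 * t)) = 4 * Real.pi * t by field_simp,
    ← Real.rpow_add (by positivity), neg_add_cancel, Real.rpow_zero]

theorem integrable_heatKernel {t : ℝ} (ht : 0 < t) : Integrable (heatKernel t : E → ℝ) :=
  integrable_of_integral_eq_one (integral_heatKernel ht)

theorem integral_heatKernel_sub_left {t : ℝ} (ht : 0 < t) (x : E) :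
    ∫ y : E, heatKernel t (x - y) = 1 := by
  rw [integral_sub_left_eq_self (fun y : E => heatKernel t y) volume x, integral_heatKernel ht]

theorem integrable_heatKernel_sub_left {t : ℝ} (ht : 0 < t) (x : E) :
    Integrable fun y : E => heatKernel t (x - y) :=
  (integrable_heatKernel ht).comp_sub_left x

/-- Completing the square: as a function of `y`, the product of two heat kernels is a heat kernel
again, centred at a convex combination of the two centres. -/
theorem heatKernel_mul_heatKernel {t τ : ℝ} (ht : 0 < t) (hτ : 0 < τ) (x y z : E) :
    heatKernel t (x - y) * heatKernel τ (y - z) = heatKernel (t + τ) (x - z) *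
      heatKernel (t * τ / (t + τ)) (y - ((τ / (t + τ)) • x + (t / (t + τ)) • z)) := by
  have hs : 0 < t + τ := by positivity
  obtain ⟨A, hA⟩ : ∃ A, A = x - y := ⟨_, rfl⟩
  obtain ⟨B, hB⟩ : ∃ B, B = y - z := ⟨_, rfl⟩
  have h1 : x - z = A + B := by rw [hA, hB]; abel
  have h2 : y - ((τ / (t + τ)) • x + (t / (t + τ)) • z)
      = (t / (t + τ)) • B - (τ / (t + τ)) • A := by
    have : y = (t / (t + τ)) • y + (τ / (t + τ)) • y := by
      rw [← add_smul, ← add_div, div_self hs.ne', one_smul]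
    rw [hA, hB, smul_sub, smul_sub]
    nth_rewrite 1 [this]
    abel
  rw [h1, h2, ← hA, ← hB]
  unfold heatKernel
  have hc : (4 * Real.pi * t) ^ (-((Module.finrank ℝ E : ℝ) / 2)) *
      (4 * Real.pi * τ) ^ (-((Module.finrank ℝ E : ℝ) / 2)) =
      (4 * Real.pi * (t + τ)) ^ (-((Module.finrank ℝ E : ℝ) / 2)) *
      (4 * Real.pi * (t * τ / (t + τ))) ^ (-((Module.finrank ℝ E : ℝ) / 2)) := by
    rw [← Real.mul_rpow (by positivity) (by positivity),
      ← Real.mul_rpow (by positivity) (by positivity)]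
    congr 1
    field_simp
  have he : -(‖A‖ ^ 2 / (4 * t)) + -(‖B‖ ^ 2 / (4 * τ)) = -(‖A + B‖ ^ 2 / (4 * (t + τ))) +
      -(‖(t / (t + τ)) • B - (τ / (t + τ)) • A‖ ^ 2 / (4 * (t * τ / (t + τ)))) := by
    rw [norm_add_sq_real, norm_sub_sq_real, norm_smul, norm_smul, real_inner_smul_left,
      real_inner_smul_right, Real.norm_of_nonneg (by positivity), Real.norm_of_nonneg (by positivity),
      real_inner_comm]
    field_simp
    ring
  calc _ = ((4 * Real.pi * t) ^ (-((Module.finrank ℝ E : ℝ) / 2)) *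
      (4 * Real.pi * τ) ^ (-((Module.finrank ℝ E : ℝ) / 2))) *
      (Real.exp (-(‖A‖ ^ 2 / (4 * t))) * Real.exp (-(‖B‖ ^ 2 / (4 * τ)))) := by ring
    _ = _ := by rw [hc, ← Real.exp_add, he, Real.exp_add]; ring

theorem integral_heatKernel_mul_heatKernel {t τ : ℝ} (ht : 0 < t) (hτ : 0 < τ) (x z : E) :
    ∫ y, heatKernel t (x - y) * heatKernel τ (y - z) = heatKernel (t + τ) (x - z) := by
  simp_rw [heatKernel_mul_heatKernel ht hτ]
  rw [integral_const_mul, integral_sub_right_eq_self (fun y : E => heatKernel _ y),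
    integral_heatKernel (by positivity), mul_one]

variable (E) in
/-- A bound for the `L¹`-distance of the heat kernels at times `t` and `t + ε`. -/
noncomputable def heatGap (ε t : ℝ) : ℝ := 2 * (Module.finrank ℝ E : ℝ) * ε / (t + ε)

theorem heatGap_nonneg {ε t : ℝ} (hε : 0 < ε) (ht : 0 < t) : 0 ≤ heatGap E ε t := by
  unfold heatGap; positivity

/-- Since `heatKernel (t + ε) ≥ λ heatKernel t` with `λ = (t / (t + ε)) ^ (d / 2)`, the total
variation distance of the two probability densities is at most `2 (1 - λ)`. -/
theorem integral_abs_heatKernel_sub_le {ε t : ℝ} (hε : 0 < ε) (ht : 0 < t) :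
    ∫ x : E, |heatKernel t x - heatKernel (t + ε) x| ≤ heatGap E ε t := by
  have hs : 0 < t + ε := by positivity
  set a : ℝ := (Module.finrank ℝ E : ℝ) / 2 with ha
  have ha0 : 0 ≤ a := by positivity
  set l : ℝ := (t / (t + ε)) ^ a with hl
  have hq0 : 0 ≤ t / (t + ε) := by positivity
  have hq1 : t / (t + ε) ≤ 1 := by rw [div_le_one hs]; linarith
  have hl1 : l ≤ 1 := Real.rpow_le_one hq0 hq1 ha0
  have hlow : ∀ x : E, l * heatKernel t x ≤ heatKernel (t + ε) x := by
    intro x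
    have h1 : l * (4 * Real.pi * t) ^ (-a) = (4 * Real.pi * (t + ε)) ^ (-a) := by
      rw [hl, Real.rpow_neg (by positivity), Real.rpow_neg (by positivity),
        ← Real.inv_rpow (by positivity), ← Real.inv_rpow (by positivity),
        ← Real.mul_rpow (by positivity) (by positivity)]
      congr 1
      field_simp
    unfold heatKernel
    rw [← ha, ← mul_assoc, h1]
    gcongr
    linarith
  -- `(1 - δ)^{d/2} ≥ (1 - δ)^d ≥ 1 - d δ` with `δ = ε / (t + ε)`
  have hbern : 1 - l ≤ (Module.finrank ℝ E : ℝ) * ε / (t + ε) := by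
    have h1 : (t / (t + ε)) ^ (Module.finrank ℝ E : ℝ) ≤ l :=
      Real.rpow_le_rpow_of_exponent_ge (by positivity) hq1 (by rw [ha]; linarith)
    have h2 : 1 + (Module.finrank ℝ E : ℝ) * (-(ε / (t + ε))) ≤
        (1 + (-(ε / (t + ε)))) ^ (Module.finrank ℝ E) := by
      apply one_add_mul_le_pow
      have : ε / (t + ε) ≤ 1 := by rw [div_le_one hs]; linarith
      linarith
    have h3 : 1 + (-(ε / (t + ε))) = t / (t + ε) := by field_simp; ring
    rw [h3, ← Real.rpow_natCast] at h2
    have h4 : (Module.finrank ℝ E : ℝ) * ε / (t + ε) = (Module.finrank ℝ E : ℝ) * (ε / (t + ε)) :=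
      mul_div_assoc _ _ _
    linarith
  have hi := integrable_heatKernel (E := E) ht
  have hi' := integrable_heatKernel (E := E) hs
  calc ∫ x : E, |heatKernel t x - heatKernel (t + ε) x|
      ≤ ∫ x : E, (heatKernel (t + ε) x + (1 - 2 * l) * heatKernel t x) := by
        refine integral_mono (hi.sub hi').abs (hi'.add (hi.const_mul _)) fun x => ?_
        have h1 := hlow x
        have h2 : l * heatKernel t x ≤ heatKernel t x :=
          mul_le_of_le_one_left (heatKernel_pos ht x).le hl1
        rw [abs_le]
        constructor <;> dsimp only <;> nlinarith
    _ = 2 * (1 - l) := by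
        rw [integral_add hi' (hi.const_mul _), integral_const_mul, integral_heatKernel ht,
          integral_heatKernel hs]
        ring
    _ ≤ heatGap E ε t := by
        unfold heatGap
        calc 2 * (1 - l) ≤ 2 * ((Module.finrank ℝ E : ℝ) * ε / (t + ε)) := by linarith
          _ = _ := by ring

theorem integrableOn_rpow_mul_heatGap {ε β : ℝ} (hε : 0 < ε) (h0 : 0 < β) (h1 : β < 1) :
    IntegrableOn (fun t => t ^ (-β) * heatGap E ε t) (Ioi 0) := by
  have hm : Measurable fun t : ℝ => t ^ (-β) * heatGap E ε t := by unfold heatGap; fun_prop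
  rw [← Ioc_union_Ioi_eq_Ioi zero_le_one]
  set D : ℝ := 2 * (Module.finrank ℝ E : ℝ) with hD
  have hD0 : 0 ≤ D := by positivity
  refine IntegrableOn.union ?_ ?_
  · have hi : IntegrableOn (fun t : ℝ => D * t ^ (-β)) (Ioc 0 1) :=
      ((intervalIntegrable_iff_integrableOn_Ioc_of_le zero_le_one).1
        (intervalIntegral.intervalIntegrable_rpow' (by linarith))).const_mul _
    refine hi.mono' hm.aestronglyMeasurable ((ae_restrict_mem measurableSet_Ioc).mono fun t ht => ?_)
    have ht0 : 0 < t := ht.1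
    rw [Real.norm_of_nonneg (mul_nonneg (by positivity) (heatGap_nonneg hε ht0)), mul_comm]
    gcongr
    unfold heatGap
    rw [← hD, div_le_iff₀ (by positivity)]
    nlinarith
  · have hi : IntegrableOn (fun t : ℝ => (D * ε) * t ^ (-β - 1)) (Ioi 1) :=
      (integrableOn_Ioi_rpow_of_lt (by linarith) one_pos).const_mul _
    refine hi.mono' hm.aestronglyMeasurable ((ae_restrict_mem measurableSet_Ioi).mono fun t ht => ?_)
    have ht0 : 0 < t := one_pos.trans ht
    rw [Real.norm_of_nonneg (mul_nonneg (by positivity) (heatGap_nonneg hε ht0)),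
      Real.rpow_sub_one ht0.ne']
    unfold heatGap
    rw [← hD]
    calc t ^ (-β) * (D * ε / (t + ε)) ≤ t ^ (-β) * (D * ε / t) := by gcongr; linarith
      _ = _ := by ring

end HeatKernel

/-! ### The heat semigroup and the mollified fractional Laplacian -/

section HeatFlow

variable {E : Type*} [NormedAddCommGroup E] [InnerProductSpace ℝ E] [FiniteDimensional ℝ E]
  [MeasurableSpace E] [BorelSpace E]

/-- The heat semigroup `P_t v = p_t * v`. -/
noncomputable def heatFlow (t : ℝ) (v : E → ℝ) (x : E) : ℝ := ∫ y, heatKernel t (x - y) * v y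

/-- Continuous, bounded and integrable functions, a class preserved by the heat semigroup. -/
structure IsTame (v : E → ℝ) : Prop where
  continuous : Continuous v
  integrable : Integrable v
  bounded : ∃ M, ∀ x, |v x| ≤ M

theorem heatFlow_eq (t : ℝ) (v : E → ℝ) (x : E) :
    heatFlow t v x = ∫ z, heatKernel t z * v (x - z) := by
  unfold heatFlow
  rw [← integral_sub_left_eq_self (fun y => heatKernel t (x - y) * v y) volume x]
  simp

theorem integrable_heatKernel_sub_mul {t : ℝ} (ht : 0 < t) {v : E → ℝ} (hv : Integrable v)
    (x : E) : Integrable fun y => heatKernel t (x - y) * v y := by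
  refine hv.bdd_mul (c := (4 * Real.pi * t) ^ (-((Module.finrank ℝ E : ℝ) / 2)))
    ((continuous_heatKernel t).comp (by fun_prop)).aestronglyMeasurable
    (Filter.Eventually.of_forall fun y => ?_)
  rw [Real.norm_of_nonneg (heatKernel_pos ht _).le]
  exact heatKernel_le ht _

theorem integrable_heatKernel_mul_sub {t : ℝ} (ht : 0 < t) {v : E → ℝ} (hv : Integrable v)
    (x : E) : Integrable fun z => heatKernel t z * v (x - z) := by
  simpa using (integrable_heatKernel_sub_mul ht hv x).comp_sub_left x

theorem abs_heatFlow_le_integral {t : ℝ} (ht : 0 < t) {v : E → ℝ} (hv : Integrable v) (x : E) :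
    |heatFlow t v x| ≤ (4 * Real.pi * t) ^ (-((Module.finrank ℝ E : ℝ) / 2)) * ∫ y, |v y| := by
  unfold heatFlow
  refine (abs_integral_le_integral_abs).trans ?_
  rw [← integral_const_mul]
  refine integral_mono (integrable_heatKernel_sub_mul ht hv x).abs (hv.abs.const_mul _) fun y => ?_
  dsimp only
  rw [abs_mul, abs_of_pos (heatKernel_pos ht _)]
  exact mul_le_mul_of_nonneg_right (heatKernel_le ht _) (abs_nonneg _)

theorem abs_heatFlow_le {t : ℝ} (ht : 0 < t) {v : E → ℝ} (hv : Integrable v) {M : ℝ}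
    (hM : ∀ x, |v x| ≤ M) (x : E) : |heatFlow t v x| ≤ M := by
  unfold heatFlow
  refine (abs_integral_le_integral_abs).trans ?_
  calc _ ≤ ∫ y, heatKernel t (x - y) * M := by
        refine integral_mono (integrable_heatKernel_sub_mul ht hv x).abs
          ((integrable_heatKernel_sub_left ht x).mul_const _) fun y => ?_
        dsimp only
        rw [abs_mul, abs_of_pos (heatKernel_pos ht _)]
        exact mul_le_mul_of_nonneg_left (hM y) (heatKernel_pos ht _).le
    _ = M := by rw [integral_mul_const, integral_heatKernel_sub_left ht, one_mul]

theorem integrable_heatFlow {t : ℝ} (ht : 0 < t) {v : E → ℝ} (hv : Integrable v) :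
    Integrable (heatFlow t v) := by
  have h := (Integrable.convolution_integrand (ContinuousLinearMap.mul ℝ ℝ) hv
    (integrable_heatKernel (E := E) ht)).integral_prod_left
  refine h.congr (Filter.Eventually.of_forall fun x => ?_)
  simp [heatFlow, mul_comm]

theorem continuous_heatFlow {t : ℝ} (ht : 0 < t) {v : E → ℝ} (hv : IsTame v) :
    Continuous (heatFlow t v) := by
  obtain ⟨M, hM⟩ := hv.bounded
  have : heatFlow t v = fun x => ∫ z, heatKernel t z * v (x - z) := funext (heatFlow_eq t v)
  rw [this]
  have hc := hv.continuous
  refine continuous_of_dominated (bound := fun z => heatKernel t z * M)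
    (fun x => ((continuous_heatKernel t).mul (by fun_prop)).aestronglyMeasurable) (fun x => ?_)
    ((integrable_heatKernel ht).mul_const _) (Filter.Eventually.of_forall fun z => by fun_prop)
  refine Filter.Eventually.of_forall fun z => ?_
  rw [norm_mul, Real.norm_of_nonneg (heatKernel_pos ht _).le]
  exact mul_le_mul_of_nonneg_left (hM _) (heatKernel_pos ht _).le

theorem IsTame.heatFlow {t : ℝ} (ht : 0 < t) {v : E → ℝ} (hv : IsTame v) :
    IsTame (heatFlow t v) where
  continuous := continuous_heatFlow ht hv
  integrable := integrable_heatFlow ht hv.integrable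
  bounded := hv.bounded.imp fun _ hM => abs_heatFlow_le ht hv.integrable hM

theorem stronglyMeasurable_heatFlow_uncurry {v : E → ℝ} (hv : Continuous v) :
    StronglyMeasurable fun p : ℝ × E => heatFlow p.1 v p.2 := by
  refine StronglyMeasurable.integral_prod_right (f := fun (p : ℝ × E) (y : E) =>
    heatKernel p.1 (p.2 - y) * v y) ?_
  refine Measurable.stronglyMeasurable ?_
  have h1 : Measurable fun q : (ℝ × E) × E => heatKernel q.1.1 (q.1.2 - q.2) :=
    measurable_heatKernel_uncurry.comp (g := fun p : ℝ × E => heatKernel p.1 p.2)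
      (f := fun q : (ℝ × E) × E => (q.1.1, q.1.2 - q.2)) (by fun_prop)
  exact h1.mul (hv.measurable.comp measurable_snd)

theorem heatFlow_heatFlow {r t : ℝ} (hr : 0 < r) (ht : 0 < t) {v : E → ℝ} (hv : IsTame v) (x : E) :
    heatFlow r (heatFlow t v) x = heatFlow (r + t) v x := by
  have hint : Integrable (Function.uncurry fun y z =>
      heatKernel r (x - y) * (heatKernel t (y - z) * v z)) ((volume : Measure E).prod volume) := by
    have h := (Integrable.convolution_integrand (ContinuousLinearMap.mul ℝ ℝ) hv.integrable
      (integrable_heatKernel (E := E) ht))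
    have h2 : Integrable (fun p : E × E => heatKernel r (x - p.1) *
        ((ContinuousLinearMap.mul ℝ ℝ) (v p.2)) (heatKernel t (p.1 - p.2)))
        ((volume : Measure E).prod volume) := by
      refine h.bdd_mul (c := (4 * Real.pi * r) ^ (-((Module.finrank ℝ E : ℝ) / 2)))
        ((continuous_heatKernel r).comp (by fun_prop)).aestronglyMeasurable
        (Filter.Eventually.of_forall fun y => ?_)
      rw [Real.norm_of_nonneg (heatKernel_pos hr _).le]
      exact heatKernel_le hr _
    refine h2.congr (Filter.Eventually.of_forall fun p => ?_)
    simp [Function.uncurry, mul_comm]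
  calc heatFlow r (heatFlow t v) x
      = ∫ y, ∫ z, heatKernel r (x - y) * (heatKernel t (y - z) * v z) := by
        simp only [heatFlow, integral_const_mul]
    _ = ∫ z, ∫ y, heatKernel r (x - y) * (heatKernel t (y - z) * v z) :=
        integral_integral_swap hint
    _ = heatFlow (r + t) v x := by
        simp only [heatFlow, ← mul_assoc, integral_mul_const,
          integral_heatKernel_mul_heatKernel hr ht]

/-- The increment `P_t v - P_{t+ε} v` of the heat flow. -/
noncomputable def heatDiff (ε : ℝ) (v : E → ℝ) (t : ℝ) (x : E) : ℝ :=
  heatFlow t v x - heatFlow (t + ε) v x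

theorem IsTame.sub {v w : E → ℝ} (hv : IsTame v) (hw : IsTame w) : IsTame fun x => v x - w x where
  continuous := hv.continuous.sub hw.continuous
  integrable := hv.integrable.sub hw.integrable
  bounded := by
    obtain ⟨M, hM⟩ := hv.bounded
    obtain ⟨N, hN⟩ := hw.bounded
    exact ⟨M + N, fun x => (abs_sub _ _).trans (add_le_add (hM x) (hN x))⟩

theorem IsTame.heatDiff {ε t : ℝ} (hε : 0 < ε) (ht : 0 < t) {v : E → ℝ} (hv : IsTame v) :
    IsTame (heatDiff ε v t) :=
  (hv.heatFlow ht).sub (hv.heatFlow (by positivity))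

theorem stronglyMeasurable_heatDiff_uncurry (ε : ℝ) {v : E → ℝ} (hv : Continuous v) :
    StronglyMeasurable fun p : ℝ × E => heatDiff ε v p.1 p.2 :=
  (stronglyMeasurable_heatFlow_uncurry hv).sub
    ((stronglyMeasurable_heatFlow_uncurry hv).comp_measurable
      (g := fun p : ℝ × E => (p.1 + ε, p.2)) (by fun_prop))

theorem heatFlow_heatDiff {ε r t : ℝ} (hε : 0 < ε) (hr : 0 < r) (ht : 0 < t) {v : E → ℝ}
    (hv : IsTame v) (x : E) : heatFlow r (heatDiff ε v t) x = heatDiff ε v (r + t) x := by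
  have ht' : 0 < t + ε := by positivity
  have h : heatFlow r (heatDiff ε v t) x =
      heatFlow r (heatFlow t v) x - heatFlow r (heatFlow (t + ε) v) x := by
    unfold heatDiff
    rw [heatFlow, heatFlow, heatFlow, ← integral_sub]
    · simp only [mul_sub]
    · exact integrable_heatKernel_sub_mul hr (integrable_heatFlow ht hv.integrable) x
    · exact integrable_heatKernel_sub_mul hr (integrable_heatFlow ht' hv.integrable) x
  rw [h, heatFlow_heatFlow hr ht hv, heatFlow_heatFlow hr ht' hv, heatDiff, add_assoc]

theorem heatDiff_eq {ε t : ℝ} (hε : 0 < ε) (ht : 0 < t) {v : E → ℝ} (hv : IsTame v) (x : E) :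
    heatDiff ε v t x = ∫ z, (heatKernel t z - heatKernel (t + ε) z) * v (x - z) := by
  rw [heatDiff, heatFlow_eq, heatFlow_eq, ← integral_sub]
  · simp only [sub_mul]
  · exact integrable_heatKernel_mul_sub ht hv.integrable x
  · exact integrable_heatKernel_mul_sub (by positivity) hv.integrable x

theorem abs_heatDiff_le {ε t : ℝ} (hε : 0 < ε) (ht : 0 < t) {v : E → ℝ} (hv : IsTame v) {M : ℝ}
    (hM : ∀ x, |v x| ≤ M) (x : E) : |heatDiff ε v t x| ≤ M * heatGap E ε t := by
  have ht' : 0 < t + ε := by positivity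
  have hM0 : 0 ≤ M := (abs_nonneg _).trans (hM 0)
  rw [heatDiff_eq hε ht hv]
  have hi := (((integrable_heatKernel (E := E) ht).sub (integrable_heatKernel ht')).abs)
  have hi2 : Integrable fun z => (heatKernel t z - heatKernel (t + ε) z) * v (x - z) := by
    simp only [sub_mul]
    exact (integrable_heatKernel_mul_sub ht hv.integrable x).sub
      (integrable_heatKernel_mul_sub ht' hv.integrable x)
  calc _ ≤ ∫ z, |(heatKernel t z - heatKernel (t + ε) z) * v (x - z)| :=
        abs_integral_le_integral_abs
    _ ≤ ∫ z, M * |heatKernel t z - heatKernel (t + ε) z| := by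
        refine integral_mono hi2.abs (hi.const_mul _) fun z => ?_
        dsimp only
        rw [abs_mul, mul_comm]
        exact mul_le_mul_of_nonneg_right (hM _) (abs_nonneg _)
    _ ≤ _ := by
        rw [integral_const_mul]
        exact mul_le_mul_of_nonneg_left (integral_abs_heatKernel_sub_le hε ht) hM0

/-- If the integrals of all translates of `|v|` against a weight `W` are at most `S`, then heat flow
increments gain the factor `heatGap E ε t`. -/
theorem lintegral_weight_mul_heatDiff_le {ε t : ℝ} (hε : 0 < ε) (ht : 0 < t) {v : E → ℝ}
    (hv : IsTame v) {W : E → ℝ≥0∞} (hW : Measurable W) {S : ℝ≥0∞}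
    (hS : ∀ z, ∫⁻ y, W y * ‖v (y - z)‖ₑ ≤ S) :
    ∫⁻ y, W y * ‖heatDiff ε v t y‖ₑ ≤ S * ENNReal.ofReal (heatGap E ε t) := by
  have ht' : 0 < t + ε := by positivity
  have hc := hv.continuous
  have hk : Continuous fun z : E => heatKernel t z - heatKernel (t + ε) z :=
    (continuous_heatKernel t).sub (continuous_heatKernel _)
  have hi : Integrable fun z : E => |heatKernel t z - heatKernel (t + ε) z| :=
    ((integrable_heatKernel ht).sub (integrable_heatKernel ht')).abs
  have hjoint : Measurable (Function.uncurry fun y z =>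
      ‖heatKernel t z - heatKernel (t + ε) z‖ₑ * (W y * ‖v (y - z)‖ₑ)) := by
    have h1 : Measurable fun p : E × E => v (p.1 - p.2) := by fun_prop
    have h2 : Measurable fun p : E × E => heatKernel t p.2 - heatKernel (t + ε) p.2 :=
      hk.measurable.comp measurable_snd
    exact h2.enorm.mul ((hW.comp measurable_fst).mul h1.enorm)
  calc ∫⁻ y, W y * ‖heatDiff ε v t y‖ₑ
      ≤ ∫⁻ y, ∫⁻ z, ‖heatKernel t z - heatKernel (t + ε) z‖ₑ * (W y * ‖v (y - z)‖ₑ) := by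
        refine lintegral_mono fun y => ?_
        rw [heatDiff_eq hε ht hv]
        calc _ ≤ W y * ∫⁻ z, ‖(heatKernel t z - heatKernel (t + ε) z) * v (y - z)‖ₑ := by
              gcongr
              exact enorm_integral_le_lintegral_enorm _
          _ = _ := by
              have h1 : Measurable fun z => (heatKernel t z - heatKernel (t + ε) z) * v (y - z) :=
                hk.measurable.mul (by fun_prop)
              rw [← lintegral_const_mul _ h1.enorm]
              refine lintegral_congr fun z => ?_
              rw [enorm_mul]
              ring
    _ = ∫⁻ z, ‖heatKernel t z - heatKernel (t + ε) z‖ₑ * ∫⁻ y, W y * ‖v (y - z)‖ₑ := by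
        rw [lintegral_lintegral_swap hjoint.aemeasurable]
        refine lintegral_congr fun z => ?_
        have hvz : Measurable fun y => v (y - z) := by fun_prop
        exact lintegral_const_mul _ (hW.mul hvz.enorm)
    _ ≤ ∫⁻ z, ‖heatKernel t z - heatKernel (t + ε) z‖ₑ * S := by
        gcongr with z
        exact hS z
    _ = S * ENNReal.ofReal (∫ z : E, |heatKernel t z - heatKernel (t + ε) z|) := by
        rw [lintegral_mul_const _ hk.measurable.enorm, mul_comm,
          ofReal_integral_eq_lintegral_ofReal hi (Filter.Eventually.of_forall fun _ => abs_nonneg _)]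
        simp only [Real.enorm_eq_ofReal_abs]
    _ ≤ _ := by gcongr; exact integral_abs_heatKernel_sub_le hε ht

/-- The integrated increments `ε⁻¹ ∫₀^∞ t^{-β} (P_t v - P_{t+ε} v) dt`. Up to a constant factor this
is the fractional Laplacian of order `2β` of the time average `ε⁻¹ ∫₀^ε P_r v dr`, see
`rieszPotential_smoothedFracLaplacian`. -/
noncomputable def smoothedFracLaplacian (β ε : ℝ) (v : E → ℝ) (x : E) : ℝ :=
  ε⁻¹ * ∫ t in Ioi (0 : ℝ), t ^ (-β) * heatDiff ε v t x

variable {β ε : ℝ} {v : E → ℝ}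

theorem integrable_weight_mul_heatDiff (hβ0 : 0 < β) (hβ1 : β < 1) (hε : 0 < ε)
    (hv : IsTame v) {W : E → ℝ} (hW : Measurable W) {S : ℝ≥0∞} (hS' : S ≠ ⊤)
    (hS : ∀ z, ∫⁻ y, ‖W y‖ₑ * ‖v (y - z)‖ₑ ≤ S) :
    Integrable (fun p : ℝ × E => W p.2 * (p.1 ^ (-β) * heatDiff ε v p.1 p.2))
      ((volume.restrict (Ioi 0)).prod volume) := by
  have hm : Measurable (fun p : ℝ × E => heatDiff ε v p.1 p.2) :=
    (stronglyMeasurable_heatDiff_uncurry ε hv.continuous).measurable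
  refine ⟨by fun_prop, ?_⟩
  rw [hasFiniteIntegral_iff_enorm, lintegral_prod _ (by fun_prop)]
  have hθ := integrableOn_rpow_mul_heatGap (E := E) hε hβ0 hβ1
  calc _ ≤ ∫⁻ t in Ioi (0 : ℝ), S * ‖t ^ (-β) * heatGap E ε t‖ₑ := by
        refine setLIntegral_mono_ae' measurableSet_Ioi (Filter.Eventually.of_forall fun t ht => ?_)
        have hDt : Measurable (heatDiff ε v t) := (hv.heatDiff hε ht).continuous.measurable
        calc _ = ∫⁻ y, ‖t ^ (-β)‖ₑ * (‖W y‖ₑ * ‖heatDiff ε v t y‖ₑ) := by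
              refine lintegral_congr fun y => ?_
              rw [enorm_mul, enorm_mul]; ring
          _ ≤ ‖t ^ (-β)‖ₑ * (S * ENNReal.ofReal (heatGap E ε t)) := by
              rw [lintegral_const_mul _ (by fun_prop)]
              gcongr
              exact lintegral_weight_mul_heatDiff_le hε ht hv (by fun_prop) hS
          _ = _ := by
              rw [enorm_mul, Real.enorm_of_nonneg (heatGap_nonneg hε ht)]; ring
    _ = S * ∫⁻ t in Ioi (0 : ℝ), ‖t ^ (-β) * heatGap E ε t‖ₑ := by
        rw [lintegral_const_mul']
        exact hS'
    _ < ⊤ := ENNReal.mul_lt_top hS'.lt_top hθ.2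

theorem integrable_weight_mul_smoothedFracLaplacian (hβ0 : 0 < β) (hβ1 : β < 1) (hε : 0 < ε)
    (hv : IsTame v) {W : E → ℝ} (hW : Measurable W) {S : ℝ≥0∞} (hS' : S ≠ ⊤)
    (hS : ∀ z, ∫⁻ y, ‖W y‖ₑ * ‖v (y - z)‖ₑ ≤ S) :
    Integrable fun y => W y * smoothedFracLaplacian β ε v y := by
  refine ((integrable_weight_mul_heatDiff hβ0 hβ1 hε hv hW hS' hS).integral_prod_right.const_mul
    ε⁻¹).congr (Filter.Eventually.of_forall fun y => ?_)
  dsimp only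
  rw [integral_const_mul, smoothedFracLaplacian]
  ring

theorem integral_weight_mul_smoothedFracLaplacian (hβ0 : 0 < β) (hβ1 : β < 1) (hε : 0 < ε)
    (hv : IsTame v) {W : E → ℝ} (hW : Measurable W) {S : ℝ≥0∞} (hS' : S ≠ ⊤)
    (hS : ∀ z, ∫⁻ y, ‖W y‖ₑ * ‖v (y - z)‖ₑ ≤ S) :
    ∫ y, W y * smoothedFracLaplacian β ε v y =
      ε⁻¹ * ∫ t in Ioi (0 : ℝ), t ^ (-β) * ∫ y, W y * heatDiff ε v t y := by
  have h := integral_integral_swap (f := fun t y => W y * (t ^ (-β) * heatDiff ε v t y))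
    (integrable_weight_mul_heatDiff hβ0 hβ1 hε hv hW hS' hS)
  calc _ = ε⁻¹ * ∫ y, ∫ t in Ioi (0 : ℝ), W y * (t ^ (-β) * heatDiff ε v t y) := by
        rw [← integral_const_mul]
        refine integral_congr_ae (Filter.Eventually.of_forall fun y => ?_)
        dsimp only
        rw [integral_const_mul, smoothedFracLaplacian]
        ring
    _ = _ := by
        rw [← h]
        congr 1
        refine integral_congr_ae (Filter.Eventually.of_forall fun t => ?_)
        dsimp only
        rw [← integral_const_mul]
        refine integral_congr_ae (Filter.Eventually.of_forall fun y => ?_)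
        dsimp only
        ring

theorem isTame_smoothedFracLaplacian (hβ0 : 0 < β) (hβ1 : β < 1) (hε : 0 < ε) (hv : IsTame v) :
    IsTame (smoothedFracLaplacian β ε v) := by
  obtain ⟨M, hM⟩ := hv.bounded
  have hm : Measurable (fun p : ℝ × E => heatDiff ε v p.1 p.2) :=
    (stronglyMeasurable_heatDiff_uncurry ε hv.continuous).measurable
  have hθ := (integrableOn_rpow_mul_heatGap (E := E) hε hβ0 hβ1).const_mul M
  have hb : ∀ x, ∀ᵐ t ∂(volume.restrict (Ioi (0 : ℝ))),
      ‖t ^ (-β) * heatDiff ε v t x‖ ≤ M * (t ^ (-β) * heatGap E ε t) := by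
    intro x
    refine (ae_restrict_mem measurableSet_Ioi).mono fun t (ht : 0 < t) => ?_
    rw [norm_mul, Real.norm_of_nonneg (by positivity), mul_left_comm]
    exact mul_le_mul_of_nonneg_left (abs_heatDiff_le hε ht hv hM x) (by positivity)
  refine ⟨?_, ?_, ?_⟩
  · refine continuous_const.mul (continuous_of_dominated (fun x => ?_) hb hθ ?_)
    · exact (by fun_prop : Measurable fun t : ℝ => t ^ (-β) * heatDiff ε v t x).aestronglyMeasurable
    · refine (ae_restrict_mem measurableSet_Ioi).mono fun t (ht : 0 < t) => ?_
      exact continuous_const.mul (hv.heatDiff hε ht).continuous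
  · simpa using integrable_weight_mul_smoothedFracLaplacian hβ0 hβ1 hε hv (W := fun _ => 1)
      measurable_const (S := ∫⁻ y, ‖v y‖ₑ) hv.integrable.2.ne fun z => by
        simp only [enorm_one, one_mul]
        exact (lintegral_sub_right_eq_self (fun y => ‖v y‖ₑ) z).le
  · refine ⟨ε⁻¹ * ∫ t in Ioi (0 : ℝ), M * (t ^ (-β) * heatGap E ε t), fun x => ?_⟩
    unfold smoothedFracLaplacian
    rw [abs_mul, abs_of_pos (inv_pos.2 hε)]
    refine mul_le_mul_of_nonneg_left ?_ (by positivity)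
    exact norm_integral_le_of_norm_le hθ (hb x)

end HeatFlow

/-! ### The Riesz kernel as a superposition of heat kernels -/

section RieszKernel

theorem integrableOn_rpow_sub_one_div_one_add {β : ℝ} (hβ0 : 0 < β) (hβ1 : β < 1) :
    IntegrableOn (fun σ : ℝ => σ ^ (β - 1) * (1 + σ)⁻¹) (Ioi 0) := by
  have h := (integrableOn_rpow_mul_heatGap (E := ℝ) one_pos (β := 1 - β) (by linarith)
    (by linarith)).const_mul (1 / 2)
  refine IntegrableOn.congr_fun h (fun t _ => ?_) measurableSet_Ioi
  simp only [heatGap, Module.finrank_self, neg_sub, add_comm t 1]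
  push_cast
  ring

/-- The Beta integral `∫₀^∞ σ^{β-1} / (1 + σ) dσ = B(β, 1 - β)`. -/
noncomputable def betaConst (β : ℝ) : ℝ := ∫ σ in Ioi (0 : ℝ), σ ^ (β - 1) * (1 + σ)⁻¹

/-- The fractional integrals of orders `1 - β` and `β` compose to an integral of order `1`: in the
inner integral substitute `r = t σ`, and then `ρ = (1 + σ) t`. -/
theorem integral_rpow_mul_integral_rpow {β : ℝ} (hβ0 : 0 < β) (hβ1 : β < 1) {φ : ℝ → ℝ}
    (hm : Measurable φ) (hφ : IntegrableOn φ (Ioi 0)) :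
    ∫ t in Ioi (0 : ℝ), t ^ (-β) * ∫ r in Ioi (0 : ℝ), r ^ (β - 1) * φ (r + t) =
      betaConst β * ∫ ρ in Ioi (0 : ℝ), φ ρ := by
  have hsub : ∀ t ∈ Ioi (0 : ℝ), t ^ (-β) * ∫ r in Ioi (0 : ℝ), r ^ (β - 1) * φ (r + t) =
      ∫ σ in Ioi (0 : ℝ), σ ^ (β - 1) * φ ((1 + σ) * t) := by
    intro t ht
    have ht : 0 < t := ht
    have h := integral_comp_mul_left_Ioi (fun r => r ^ (β - 1) * φ (r + t)) 0 ht
    rw [mul_zero, smul_eq_mul, inv_mul_eq_div, eq_div_iff ht.ne'] at h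
    rw [← h, mul_comm _ t, ← integral_const_mul, ← integral_const_mul]
    · refine setIntegral_congr_fun measurableSet_Ioi fun σ (hσ : 0 < σ) => ?_
      have h1 : t ^ (-β) * t ^ (β - 1) * t = 1 := by
        rw [← Real.rpow_add ht, ← Real.rpow_add_one ht.ne',
          show -β + (β - 1) + 1 = 0 by ring, Real.rpow_zero]
      rw [Real.mul_rpow ht.le hσ.le, show t * σ + t = (1 + σ) * t by ring]
      linear_combination (σ ^ (β - 1) * φ ((1 + σ) * t)) * h1
  rw [setIntegral_congr_fun measurableSet_Ioi hsub]
  have hscale : ∀ (ψ : ℝ → ℝ), ∀ σ ∈ Ioi (0 : ℝ), ∫ t in Ioi (0 : ℝ), ψ ((1 + σ) * t) =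
      (1 + σ)⁻¹ * ∫ t in Ioi (0 : ℝ), ψ t := by
    intro ψ σ hσ
    have hσ : 0 < σ := hσ
    rw [integral_comp_mul_left_Ioi ψ 0 (by positivity : 0 < 1 + σ), mul_zero, smul_eq_mul]
  have hint : Integrable (Function.uncurry fun σ t : ℝ => σ ^ (β - 1) * φ ((1 + σ) * t))
      ((volume.restrict (Ioi 0)).prod (volume.restrict (Ioi 0))) := by
    rw [integrable_prod_iff (by
      unfold Function.uncurry; exact (by fun_prop : Measurable _).aestronglyMeasurable)]
    constructor
    · refine (ae_restrict_mem measurableSet_Ioi).mono fun σ (hσ : 0 < σ) => ?_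
      refine Integrable.const_mul (c := σ ^ (β - 1)) (f := fun t => φ ((1 + σ) * t)) ?_
      have := (integrableOn_Ioi_comp_mul_left_iff φ 0 (by positivity : 0 < 1 + σ)).2
        (by rwa [mul_zero])
      exact this
    · refine IntegrableOn.congr_fun ((integrableOn_rpow_sub_one_div_one_add hβ0 hβ1).mul_const
        (∫ t in Ioi (0 : ℝ), ‖φ t‖)) (fun σ hσ => ?_) measurableSet_Ioi
      have hσ' : 0 < σ := hσ
      simp only [Function.uncurry, norm_mul]
      rw [integral_const_mul, hscale (fun t => ‖φ t‖) σ hσ, Real.norm_of_nonneg (by positivity)]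
      ring
  rw [← integral_integral_swap hint, betaConst, ← integral_mul_const]
  refine setIntegral_congr_fun measurableSet_Ioi fun σ hσ => ?_
  rw [integral_const_mul, hscale φ σ hσ]
  ring

/-- `∫₀^∞ (f(t) - f(t + ε)) dt = ∫₀^ε f` for `f` vanishing at infinity. -/
theorem integral_Ioi_sub_shift {f : ℝ → ℝ} {ε : ℝ}
    (hf : ∀ a b, 0 ≤ a → 0 ≤ b → IntervalIntegrable f volume a b)
    (hlim : Filter.Tendsto f Filter.atTop (nhds 0)) (hε : 0 < ε)
    (hint : IntegrableOn (fun t => f t - f (t + ε)) (Ioi 0)) :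
    ∫ t in Ioi (0 : ℝ), (f t - f (t + ε)) = ∫ r in (0 : ℝ)..ε, f r := by
  have h1 := intervalIntegral_tendsto_integral_Ioi 0 hint Filter.tendsto_id
  have h2 : ∀ R ≥ (0 : ℝ), ∫ t in (0 : ℝ)..R, (f t - f (t + ε)) =
      (∫ r in (0 : ℝ)..ε, f r) - ∫ r in R..(R + ε), f r := by
    intro R hR
    have hs : IntervalIntegrable (fun t => f (t + ε)) volume 0 R := by
      have := (hf ε (R + ε) hε.le (by positivity)).comp_add_right ε
      simpa using this
    rw [intervalIntegral.integral_sub (hf 0 R le_rfl hR) hs,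
      intervalIntegral.integral_comp_add_right, zero_add]
    have e1 := intervalIntegral.integral_add_adjacent_intervals (hf 0 R le_rfl hR)
      (hf R (R + ε) hR (by positivity))
    have e2 := intervalIntegral.integral_add_adjacent_intervals (hf 0 ε le_rfl hε.le)
      (hf ε (R + ε) hε.le (by positivity))
    linarith
  have h3 : Filter.Tendsto (fun R => ∫ r in R..(R + ε), f r) Filter.atTop (nhds 0) := by
    rw [Metric.tendsto_atTop]
    intro δ hδ
    obtain ⟨N, hN⟩ := (Metric.tendsto_atTop.1 hlim) (δ / (2 * ε)) (by positivity)
    refine ⟨N, fun R hR => ?_⟩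
    rw [dist_zero_right]
    have := intervalIntegral.norm_integral_le_of_norm_le_const (a := R) (b := R + ε) (f := f)
      (C := δ / (2 * ε)) fun x hx => by
        rw [uIoc_of_le (by linarith)] at hx
        have := hN x (hR.trans hx.1.le)
        rw [dist_zero_right] at this
        exact this.le
    refine this.trans_lt ?_
    rw [add_sub_cancel_left, abs_of_pos hε]
    field_simp
    linarith
  have h4 : Filter.Tendsto (fun R => ∫ t in (0 : ℝ)..R, (f t - f (t + ε))) Filter.atTop
      (nhds (∫ r in (0 : ℝ)..ε, f r)) := by
    have := (tendsto_const_nhds (x := ∫ r in (0 : ℝ)..ε, f r) (f := Filter.atTop)).sub h3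
    rw [sub_zero] at this
    refine this.congr' ?_
    filter_upwards [Filter.eventually_ge_atTop 0] with R hR
    exact (h2 R hR).symm
  exact tendsto_nhds_unique h1 h4

variable {E : Type*} [NormedAddCommGroup E] [InnerProductSpace ℝ E] [FiniteDimensional ℝ E]
  [MeasurableSpace E] [BorelSpace E]

variable (E) in
/-- The constant `∫₀^∞ σ^{s/2-1} (4πσ)^{-d/2} e^{-1/(4σ)} dσ`, the ratio between the superposition of
heat kernels with weight `t^{s/2-1}` and the Riesz kernel `‖x‖^{-(d-s)}`. -/
noncomputable def heatRieszConst (s : ℝ) : ℝ :=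
  ∫ σ in Ioi (0 : ℝ), σ ^ (s / 2 - 1) *
    ((4 * Real.pi * σ) ^ (-((Module.finrank ℝ E : ℝ) / 2)) * Real.exp (-(1 / (4 * σ))))

variable {s : ℝ}

theorem integrableOn_heatRieszConst (hs : s < Module.finrank ℝ E) :
    IntegrableOn (fun σ : ℝ => σ ^ (s / 2 - 1) *
      ((4 * Real.pi * σ) ^ (-((Module.finrank ℝ E : ℝ) / 2)) * Real.exp (-(1 / (4 * σ)))))
      (Ioi 0) := by
  set a : ℝ := ((Module.finrank ℝ E : ℝ) - s) / 2 with ha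
  have ha0 : 0 < a := by rw [ha]; linarith
  -- the substitution `y = 1 / σ` turns the integral into a Gamma integral
  have h1 : IntegrableOn (fun y : ℝ => y ^ (a - 1) * Real.exp (-(1 / 4) * y)) (Ioi 0) := by
    have := integrableOn_rpow_mul_exp_neg_mul_rpow (s := a - 1) (p := 1) (b := 1 / 4)
      (by linarith) one_pos (by norm_num)
    simpa using this
  have h2 := ((integrableOn_Ioi_comp_rpow_iff _ (by norm_num : (-1 : ℝ) ≠ 0)).2 h1).const_mul
    ((4 * Real.pi) ^ (-((Module.finrank ℝ E : ℝ) / 2)))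
  refine IntegrableOn.congr_fun h2 (fun x (hx : 0 < x) => ?_) measurableSet_Ioi
  have e1 : (x ^ (-1 : ℝ)) ^ (a - 1) = x ^ (1 - a) := by
    rw [← Real.rpow_mul hx.le]; congr 1; ring
  have e2 : x ^ ((-1 : ℝ) - 1) * x ^ (1 - a) =
      x ^ (s / 2 - 1) * x ^ (-((Module.finrank ℝ E : ℝ) / 2)) := by
    rw [← Real.rpow_add hx, ← Real.rpow_add hx]; congr 1; rw [ha]; ring
  have e3 : -(1 / 4) * x ^ (-1 : ℝ) = -(1 / (4 * x)) := by
    rw [Real.rpow_neg_one]; field_simp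
  simp only [smul_eq_mul]
  rw [e1, e3, Real.mul_rpow (by positivity) hx.le, abs_neg, abs_one, one_mul]
  linear_combination ((4 * Real.pi) ^ (-((Module.finrank ℝ E : ℝ) / 2)) *
    Real.exp (-(1 / (4 * x)))) * e2

theorem heatRieszConst_pos (hs : s < Module.finrank ℝ E) : 0 < heatRieszConst E s := by
  unfold heatRieszConst
  rw [setIntegral_pos_iff_support_of_nonneg_ae
    ((ae_restrict_mem measurableSet_Ioi).mono fun σ (hσ : 0 < σ) => by
      simp only [Pi.zero_apply]; positivity) (integrableOn_heatRieszConst hs)]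
  refine lt_of_lt_of_le ?_ (measure_mono (s := Ioi (0 : ℝ)) fun σ (hσ : 0 < σ) => ⟨?_, hσ⟩)
  · simp
  · rw [Function.mem_support]; positivity

theorem rpow_mul_heatKernel_scale {z : E} (hz : z ≠ 0) {σ : ℝ} (hσ : 0 < σ) :
    (‖z‖ ^ 2 * σ) ^ (s / 2 - 1) * heatKernel (‖z‖ ^ 2 * σ) z =
      ((‖z‖ ^ 2)⁻¹ * (‖z‖ ^ ((Module.finrank ℝ E : ℝ) - s))⁻¹) * (σ ^ (s / 2 - 1) *
        ((4 * Real.pi * σ) ^ (-((Module.finrank ℝ E : ℝ) / 2)) * Real.exp (-(1 / (4 * σ))))) := by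
  have hn : 0 < ‖z‖ := norm_pos_iff.2 hz
  have hb : 0 < ‖z‖ ^ 2 := by positivity
  unfold heatKernel
  have e1 : ‖z‖ ^ 2 / (4 * (‖z‖ ^ 2 * σ)) = 1 / (4 * σ) := by field_simp
  have e2 : 4 * Real.pi * (‖z‖ ^ 2 * σ) = ‖z‖ ^ 2 * (4 * Real.pi * σ) := by ring
  have e3 : (‖z‖ ^ 2) ^ (s / 2 - 1) * (‖z‖ ^ 2) ^ (-((Module.finrank ℝ E : ℝ) / 2)) =
      (‖z‖ ^ 2)⁻¹ * (‖z‖ ^ ((Module.finrank ℝ E : ℝ) - s))⁻¹ := by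
    rw [← Real.rpow_natCast, ← Real.rpow_mul hn.le, ← Real.rpow_mul hn.le, ← Real.rpow_neg hn.le,
      ← Real.rpow_neg hn.le, ← Real.rpow_add hn, ← Real.rpow_add hn]
    congr 1
    push_cast
    ring
  rw [e1, e2, Real.mul_rpow hb.le hσ.le, Real.mul_rpow hb.le (by positivity)]
  linear_combination (σ ^ (s / 2 - 1) *
        ((4 * Real.pi * σ) ^ (-((Module.finrank ℝ E : ℝ) / 2)) * Real.exp (-(1 / (4 * σ))))) * e3

/-- The Riesz kernel is a superposition of heat kernels. -/
theorem integral_rpow_mul_heatKernel {z : E} (hz : z ≠ 0) :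
    ∫ t in Ioi (0 : ℝ), t ^ (s / 2 - 1) * heatKernel t z =
      heatRieszConst E s * (‖z‖ ^ ((Module.finrank ℝ E : ℝ) - s))⁻¹ := by
  have hb : 0 < ‖z‖ ^ 2 := by have := norm_pos_iff.2 hz; positivity
  have h := integral_comp_mul_left_Ioi (fun t => t ^ (s / 2 - 1) * heatKernel t z) 0 hb
  rw [mul_zero, smul_eq_mul, setIntegral_congr_fun measurableSet_Ioi
    (fun σ (hσ : 0 < σ) => rpow_mul_heatKernel_scale hz hσ), integral_const_mul, mul_assoc] at h
  have := mul_left_cancel₀ (inv_ne_zero hb.ne') h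
  rw [← this, heatRieszConst, mul_comm]

end RieszKernel

/-! ### The Riesz potential of the mollified fractional Laplacian -/

section RieszPotential

variable {E : Type*} [NormedAddCommGroup E] [InnerProductSpace ℝ E] [FiniteDimensional ℝ E]
  [MeasurableSpace E] [BorelSpace E] {s ε : ℝ} {v : E → ℝ}

theorem rpow_neg_half_finrank_le [Nontrivial E] {t : ℝ} (ht : 1 ≤ t) :
    (4 * Real.pi * t) ^ (-((Module.finrank ℝ E : ℝ) / 2)) ≤ t ^ (-(1 / 2) : ℝ) := by
  have hd : (1 : ℝ) ≤ Module.finrank ℝ E := by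
    exact_mod_cast Nat.succ_le_of_lt (Module.finrank_pos (R := ℝ) (M := E))
  have hπ : 1 ≤ 4 * Real.pi := by linarith [Real.pi_gt_three]
  calc (4 * Real.pi * t) ^ (-((Module.finrank ℝ E : ℝ) / 2))
      ≤ t ^ (-((Module.finrank ℝ E : ℝ) / 2)) :=
        Real.rpow_le_rpow_of_nonpos (by linarith) (by nlinarith) (by linarith)
    _ ≤ t ^ (-(1 / 2) : ℝ) := Real.rpow_le_rpow_of_exponent_le ht (by linarith)

/-- Near `t = 0` the heat flow of `|v|` is bounded by `sup |v|`, for large `t` by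
`t^{-1/2} ∫ |v|`. -/
theorem exists_lintegral_heatKernel_mul_le [Nontrivial E] (hs0 : 0 < s) (hs1 : s < 1)
    (hv : IsTame v) : ∃ S : ℝ≥0∞, S ≠ ⊤ ∧ ∀ x z : E, ∫⁻ t in Ioi (0 : ℝ), ∫⁻ y,
      ‖t ^ (s / 2 - 1) * heatKernel t (x - y) * v (y - z)‖ₑ ≤ S := by
  obtain ⟨M, hM⟩ := hv.bounded
  have hM0 : 0 ≤ M := (abs_nonneg _).trans (hM 0)
  set I : ℝ := ∫ y, |v y| with hI
  have hI0 : 0 ≤ I := integral_nonneg fun _ => abs_nonneg _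
  have h1 : IntegrableOn (fun t : ℝ => t ^ (s / 2 - 1) * M) (Ioc 0 1) :=
    ((intervalIntegrable_iff_integrableOn_Ioc_of_le zero_le_one).1
      (intervalIntegral.intervalIntegrable_rpow' (by linarith))).mul_const _
  have h2 : IntegrableOn (fun t : ℝ => t ^ (s / 2 - 1 + -(1 / 2)) * I) (Ioi 1) :=
    (integrableOn_Ioi_rpow_of_lt (by linarith) one_pos).mul_const _
  have key : ∀ t : ℝ, 0 < t → ∀ (x z : E), ∀ b : ℝ, ∫ y, heatKernel t (x - y) * |v (y - z)| ≤ b →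
      ∫⁻ y, ‖t ^ (s / 2 - 1) * heatKernel t (x - y) * v (y - z)‖ₑ ≤ ‖t ^ (s / 2 - 1) * b‖ₑ := by
    intro t ht x z b hb
    have hi : Integrable fun y => t ^ (s / 2 - 1) * (heatKernel t (x - y) * |v (y - z)|) :=
      (integrable_heatKernel_sub_mul ht (v := fun y => |v (y - z)|)
        (hv.integrable.comp_sub_right z).abs x).const_mul _
    have hn : ∀ y, 0 ≤ heatKernel t (x - y) * |v (y - z)| := fun y =>
      mul_nonneg (heatKernel_pos ht _).le (abs_nonneg _)
    have hb0 : 0 ≤ b := (integral_nonneg hn).trans hb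
    rw [Real.enorm_of_nonneg (by positivity)]
    calc _ = ∫⁻ y, ENNReal.ofReal (t ^ (s / 2 - 1) * (heatKernel t (x - y) * |v (y - z)|)) := by
          refine lintegral_congr fun y => ?_
          rw [Real.enorm_eq_ofReal_abs, abs_mul, abs_mul, abs_of_pos (heatKernel_pos ht _),
            abs_of_pos (by positivity), mul_assoc]
      _ = ENNReal.ofReal (t ^ (s / 2 - 1) * ∫ y, (heatKernel t (x - y) * |v (y - z)|)) := by
          rw [← integral_const_mul, ofReal_integral_eq_lintegral_ofReal hi
            (Filter.Eventually.of_forall fun y => mul_nonneg (by positivity) (hn y))]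
      _ ≤ _ := by gcongr
  have hvz : ∀ z, Integrable fun y => |v (y - z)| := fun z => (hv.integrable.comp_sub_right z).abs
  refine ⟨(∫⁻ t in Ioc (0 : ℝ) 1, ‖t ^ (s / 2 - 1) * M‖ₑ) +
    ∫⁻ t in Ioi (1 : ℝ), ‖t ^ (s / 2 - 1 + -(1 / 2)) * I‖ₑ, ?_, fun x z => ?_⟩
  · exact (ENNReal.add_lt_top.2 ⟨h1.2, h2.2⟩).ne
  rw [← Ioc_union_Ioi_eq_Ioi zero_le_one]
  refine (lintegral_union_le _ _ _).trans (add_le_add ?_ ?_)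
  · refine setLIntegral_mono_ae' measurableSet_Ioc (Filter.Eventually.of_forall fun t ht => ?_)
    refine key t ht.1 x z M ((le_abs_self _).trans ?_)
    exact abs_heatFlow_le (v := fun y => |v (y - z)|) ht.1 (hvz z)
      (fun y => by rw [abs_abs]; exact hM _) x
  · refine setLIntegral_mono_ae' measurableSet_Ioi (Filter.Eventually.of_forall fun t ht => ?_)
    have ht1 : 1 < t := ht
    have ht0 : 0 < t := one_pos.trans ht1
    rw [Real.rpow_add ht0, mul_assoc]
    refine key t ht0 x z _ ((le_abs_self _).trans ?_)
    refine (abs_heatFlow_le_integral (v := fun y => |v (y - z)|) ht0 (hvz z) x).trans ?_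
    simp only [abs_abs]
    rw [integral_sub_right_eq_self (fun y => |v y|) z]
    exact mul_le_mul_of_nonneg_right (rpow_neg_half_finrank_le ht1.le) hI0

theorem ae_inv_norm_rpow_eq [Nontrivial E] (hs1 : s < 1) (x : E) :
    ∀ᵐ y : E, (‖x - y‖ ^ ((Module.finrank ℝ E : ℝ) - s))⁻¹ =
      (heatRieszConst E s)⁻¹ * ∫ t in Ioi (0 : ℝ), t ^ (s / 2 - 1) * heatKernel t (x - y) := by
  have hd : (1 : ℝ) ≤ Module.finrank ℝ E := by
    exact_mod_cast Nat.succ_le_of_lt (Module.finrank_pos (R := ℝ) (M := E))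
  filter_upwards [(measure_eq_zero_iff_ae_notMem (μ := volume)).1 (measure_singleton x)] with y hy
  rw [integral_rpow_mul_heatKernel (sub_ne_zero.2 fun h => hy (by simp [h])),
    inv_mul_cancel_left₀ (heatRieszConst_pos (by linarith)).ne']

/-- The Riesz kernel is an admissible weight for bounded integrable functions. -/
theorem exists_lintegral_rieszKernel_mul_le [Nontrivial E] (hs0 : 0 < s) (hs1 : s < 1)
    (hv : IsTame v) (x : E) : ∃ S : ℝ≥0∞, S ≠ ⊤ ∧ ∀ z : E, ∫⁻ y,
      ‖(‖x - y‖ ^ ((Module.finrank ℝ E : ℝ) - s))⁻¹‖ₑ * ‖v (y - z)‖ₑ ≤ S := by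
  obtain ⟨S, hS, h⟩ := exists_lintegral_heatKernel_mul_le hs0 hs1 hv
  refine ⟨‖(heatRieszConst E s)⁻¹‖ₑ * S, ENNReal.mul_ne_top enorm_ne_top hS, fun z => ?_⟩
  have hv' := hv.continuous.measurable
  have hk : Measurable fun p : E × ℝ => heatKernel p.2 (x - p.1) :=
    measurable_heatKernel_uncurry.comp (g := fun p : ℝ × E => heatKernel p.1 p.2)
      (f := fun q : E × ℝ => (q.2, x - q.1)) (by fun_prop)
  have hmeas : Measurable (Function.uncurry fun (y : E) (t : ℝ) =>
      ‖t ^ (s / 2 - 1) * heatKernel t (x - y) * v (y - z)‖ₑ) := by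
    unfold Function.uncurry
    exact (((by fun_prop : Measurable fun q : E × ℝ => q.2 ^ (s / 2 - 1)).mul hk).mul
      (by fun_prop)).enorm
  calc ∫⁻ y, ‖(‖x - y‖ ^ ((Module.finrank ℝ E : ℝ) - s))⁻¹‖ₑ * ‖v (y - z)‖ₑ
      ≤ ∫⁻ y, ‖(heatRieszConst E s)⁻¹‖ₑ * ∫⁻ t in Ioi (0 : ℝ),
          ‖t ^ (s / 2 - 1) * heatKernel t (x - y) * v (y - z)‖ₑ := by
        refine lintegral_mono_ae ?_
        filter_upwards [ae_inv_norm_rpow_eq (E := E) hs1 x] with y hy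
        rw [hy, enorm_mul, mul_assoc]
        gcongr
        simp only [enorm_mul (_ * _) (v _)]
        rw [lintegral_mul_const' _ _ enorm_ne_top]
        gcongr
        exact enorm_integral_le_lintegral_enorm _
    _ = ‖(heatRieszConst E s)⁻¹‖ₑ * ∫⁻ t in Ioi (0 : ℝ), ∫⁻ y,
          ‖t ^ (s / 2 - 1) * heatKernel t (x - y) * v (y - z)‖ₑ := by
        rw [lintegral_const_mul' _ _ enorm_ne_top, lintegral_lintegral_swap hmeas.aemeasurable]
    _ ≤ _ := by gcongr; exact h x z

/-- The Riesz potential of a bounded integrable function in terms of its heat flow. -/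
theorem integral_rieszKernel_mul [Nontrivial E] (hs0 : 0 < s) (hs1 : s < 1)
    (hv : IsTame v) (x : E) :
    ∫ y, (‖x - y‖ ^ ((Module.finrank ℝ E : ℝ) - s))⁻¹ * v y =
      (heatRieszConst E s)⁻¹ * ∫ t in Ioi (0 : ℝ), t ^ (s / 2 - 1) * heatFlow t v x := by
  obtain ⟨S, hS, h⟩ := exists_lintegral_heatKernel_mul_le hs0 hs1 hv
  have hv' := hv.continuous.measurable
  have hk : Measurable fun p : ℝ × E => heatKernel p.1 (x - p.2) :=
    measurable_heatKernel_uncurry.comp (g := fun p : ℝ × E => heatKernel p.1 p.2)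
      (f := fun q : ℝ × E => (q.1, x - q.2)) (by fun_prop)
  have hmeas : Measurable (Function.uncurry fun (t : ℝ) (y : E) =>
      t ^ (s / 2 - 1) * heatKernel t (x - y) * v y) := by
    unfold Function.uncurry
    exact ((by fun_prop : Measurable fun q : ℝ × E => q.1 ^ (s / 2 - 1)).mul hk).mul
      (by fun_prop)
  have hint : Integrable (Function.uncurry fun (t : ℝ) (y : E) =>
      t ^ (s / 2 - 1) * heatKernel t (x - y) * v y)
      ((volume.restrict (Ioi 0)).prod volume) := by
    refine ⟨hmeas.aestronglyMeasurable, ?_⟩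
    rw [hasFiniteIntegral_iff_enorm, lintegral_prod _ hmeas.enorm.aemeasurable]
    refine lt_of_le_of_lt ?_ hS.lt_top
    simpa [Function.uncurry] using h x 0
  calc _ = ∫ y, (heatRieszConst E s)⁻¹ * ∫ t in Ioi (0 : ℝ),
          t ^ (s / 2 - 1) * heatKernel t (x - y) * v y := by
        refine integral_congr_ae ?_
        filter_upwards [ae_inv_norm_rpow_eq (E := E) hs1 x] with y hy
        rw [hy, integral_mul_const, mul_assoc]
    _ = _ := by
        rw [integral_const_mul, ← integral_integral_swap hint]
        simp only [mul_assoc, integral_const_mul, heatFlow]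

/-- The factor `heatGap E ε t` is of order `1 / t`, which is not integrable at infinity; writing
`P_{2τ} v - P_{2τ+ε} v = P_τ (P_τ v - P_{τ+ε} v)` gains a further power of `t`. -/
theorem integrableOn_heatDiff [Nontrivial E] (hε : 0 < ε) (hv : IsTame v) (x : E) :
    IntegrableOn (fun t => heatDiff ε v t x) (Ioi 0) := by
  obtain ⟨M, hM⟩ := hv.bounded
  have hM0 : 0 ≤ M := (abs_nonneg _).trans (hM 0)
  have hm : Measurable fun t => heatDiff ε v t x :=
    (stronglyMeasurable_heatDiff_uncurry ε hv.continuous).measurable.comp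
      (g := fun p : ℝ × E => heatDiff ε v p.1 p.2) (f := fun t => (t, x)) (by fun_prop)
  set d : ℝ := (Module.finrank ℝ E : ℝ) with hd
  have hd0 : 0 ≤ d := by positivity
  rw [← Ioc_union_Ioi_eq_Ioi (by norm_num : (0 : ℝ) ≤ 2)]
  refine IntegrableOn.union ?_ ?_
  · refine Integrable.mono' (g := fun _ => M * (2 * d)) (integrableOn_const measure_Ioc_lt_top.ne) hm.aestronglyMeasurable
      ((ae_restrict_mem measurableSet_Ioc).mono fun t ht => ?_)
    have ht0 : 0 < t := ht.1
    refine (abs_heatDiff_le hε ht.1 hv hM x).trans ?_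
    gcongr
    unfold heatGap
    rw [← hd, div_le_iff₀ (by positivity)]
    nlinarith [mul_nonneg hd0 ht0.le]
  · set I : ℝ := ∫ y, |v y| with hI
    have hI0 : 0 ≤ I := integral_nonneg fun _ => abs_nonneg _
    have hi : IntegrableOn (fun t : ℝ => (4 * d * ε * I) * (t / 2) ^ (-(1 / 2) - 1 : ℝ))
        (Ioi 2) := by
      refine Integrable.const_mul ?_ _
      have := (integrableOn_Ioi_comp_mul_left_iff (fun t : ℝ => t ^ (-(1 / 2) - 1 : ℝ)) 2
        (by norm_num : (0 : ℝ) < 1 / 2)).2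
        (by norm_num; exact integrableOn_Ioi_rpow_of_lt (by norm_num) one_pos)
      refine IntegrableOn.congr_fun this (fun t _ => ?_) measurableSet_Ioi
      rw [one_div_mul_eq_div]
    refine hi.mono' hm.aestronglyMeasurable ((ae_restrict_mem measurableSet_Ioi).mono fun t ht => ?_)
    -- halve the time: one half supplies the decay of the heat kernel, the other the small factor
    obtain ⟨τ, rfl⟩ : ∃ τ, t = τ + τ := ⟨t / 2, by ring⟩
    have hτ1 : 1 < τ := by have : 2 < τ + τ := ht; linarith
    have hτ : 0 < τ := by linarith
    have hDI : ∫ y, |heatDiff ε v τ y| ≤ heatGap E ε τ * I := by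
      have h := lintegral_weight_mul_heatDiff_le hε hτ hv (W := fun _ => 1) measurable_const
        (S := ENNReal.ofReal I) fun z => by
          rw [hI, ofReal_integral_eq_lintegral_ofReal hv.integrable.abs
            (Filter.Eventually.of_forall fun _ => abs_nonneg _)]
          simp only [one_mul, ← Real.enorm_eq_ofReal_abs]
          exact (lintegral_sub_right_eq_self (fun y => ‖v y‖ₑ) z).le
      simp only [one_mul, Real.enorm_eq_ofReal_abs] at h
      rw [← ofReal_integral_eq_lintegral_ofReal (hv.heatDiff hε hτ).integrable.abs
        (Filter.Eventually.of_forall fun _ => abs_nonneg _), ← ENNReal.ofReal_mul hI0,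
        ENNReal.ofReal_le_ofReal_iff (mul_nonneg hI0 (heatGap_nonneg hε hτ)), mul_comm] at h
      exact h
    rw [← heatFlow_heatDiff hε hτ hτ hv]
    refine (abs_heatFlow_le_integral hτ (hv.heatDiff hε hτ).integrable x).trans ?_
    calc _ ≤ τ ^ (-(1 / 2) : ℝ) * (heatGap E ε τ * I) :=
          mul_le_mul (rpow_neg_half_finrank_le hτ1.le) hDI
            (integral_nonneg fun _ => abs_nonneg _) (by positivity)
      _ ≤ τ ^ (-(1 / 2) : ℝ) * (2 * d * ε / τ * I) := by
          unfold heatGap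
          rw [← hd]
          gcongr
          linarith
      _ ≤ _ := by
          rw [show (τ + τ) / 2 = τ by ring, Real.rpow_sub_one hτ.ne']
          have : 0 ≤ d * ε * I * (τ ^ (-(1 / 2) : ℝ) / τ) := by positivity
          calc _ = 2 * (d * ε * I * (τ ^ (-(1 / 2) : ℝ) / τ)) := by ring
            _ ≤ 4 * (d * ε * I * (τ ^ (-(1 / 2) : ℝ) / τ)) := by linarith
            _ = _ := by ring

theorem intervalIntegrable_heatFlow (hv : IsTame v) (x : E) {a b : ℝ} (ha : 0 ≤ a) (hb : 0 ≤ b) :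
    IntervalIntegrable (fun t => heatFlow t v x) volume a b := by
  obtain ⟨M, hM⟩ := hv.bounded
  rw [intervalIntegrable_iff]
  have hm : Measurable fun t => heatFlow t v x :=
    (stronglyMeasurable_heatFlow_uncurry hv.continuous).measurable.comp
      (g := fun p : ℝ × E => heatFlow p.1 v p.2) (f := fun t => (t, x)) (by fun_prop)
  refine Integrable.mono' (g := fun _ => M)
    (integrableOn_const (by rw [Real.volume_uIoc]; exact ENNReal.ofReal_ne_top)) hm.aestronglyMeasurable
    ((ae_restrict_mem measurableSet_uIoc).mono fun t ht => ?_)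
  exact abs_heatFlow_le ((le_min ha hb).trans_lt ht.1) hv.integrable hM x

theorem tendsto_heatFlow_atTop [Nontrivial E] (hv : IsTame v) (x : E) :
    Filter.Tendsto (fun t => heatFlow t v x) Filter.atTop (nhds 0) := by
  have h : Filter.Tendsto (fun t : ℝ => t ^ (-(1 / 2) : ℝ) * ∫ y, |v y|) Filter.atTop (nhds 0) := by
    have := (tendsto_rpow_neg_atTop (y := 1 / 2) (by norm_num)).mul_const (∫ y, |v y|)
    rwa [zero_mul] at this
  refine squeeze_zero_norm' ?_ h
  filter_upwards [Filter.eventually_ge_atTop 1] with t ht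
  refine (abs_heatFlow_le_integral (by linarith) hv.integrable x).trans ?_
  exact mul_le_mul_of_nonneg_right (rpow_neg_half_finrank_le ht)
    (integral_nonneg fun _ => abs_nonneg _)

/-- By the semigroup law, applying the Riesz potential of order `s` to the fractional Laplacian of
order `s` produces `∫₀^∞ (P_ρ v - P_{ρ+ε} v) dρ`, which telescopes to `∫₀^ε P_r v dr`. -/
theorem rieszPotential_smoothedFracLaplacian [Nontrivial E] (hs0 : 0 < s) (hs1 : s < 1)
    (hε : 0 < ε) (hv : IsTame v) (x : E) :
    ∫ y, smoothedFracLaplacian (s / 2) ε v y / ‖x - y‖ ^ ((Module.finrank ℝ E : ℝ) - s) =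
      (heatRieszConst E s)⁻¹ * betaConst (s / 2) *
        (ε⁻¹ * ∫ r in (0 : ℝ)..ε, heatFlow r v x) := by
  obtain ⟨S, hS', hS⟩ := exists_lintegral_rieszKernel_mul_le hs0 hs1 hv x
  have hW : Measurable fun y : E => (‖x - y‖ ^ ((Module.finrank ℝ E : ℝ) - s))⁻¹ := by fun_prop
  have hm : Measurable fun t => heatDiff ε v t x :=
    (stronglyMeasurable_heatDiff_uncurry ε hv.continuous).measurable.comp
      (g := fun p : ℝ × E => heatDiff ε v p.1 p.2) (f := fun t => (t, x)) (by fun_prop)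
  have h1 : ∀ t ∈ Ioi (0 : ℝ), t ^ (-(s / 2)) *
      ∫ y, (‖x - y‖ ^ ((Module.finrank ℝ E : ℝ) - s))⁻¹ * heatDiff ε v t y =
      (heatRieszConst E s)⁻¹ * (t ^ (-(s / 2)) *
        ∫ r in Ioi (0 : ℝ), r ^ (s / 2 - 1) * heatDiff ε v (r + t) x) := by
    intro t ht
    rw [integral_rieszKernel_mul hs0 hs1 (hv.heatDiff hε ht) x, setIntegral_congr_fun
      measurableSet_Ioi fun r hr => by rw [heatFlow_heatDiff hε hr ht hv]]
    ring
  calc _ = ∫ y, (‖x - y‖ ^ ((Module.finrank ℝ E : ℝ) - s))⁻¹ *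
        smoothedFracLaplacian (s / 2) ε v y := by
        simp only [div_eq_mul_inv, mul_comm]
    _ = _ := by
        rw [integral_weight_mul_smoothedFracLaplacian (by linarith) (by linarith) hε hv hW hS' hS,
          setIntegral_congr_fun measurableSet_Ioi h1, integral_const_mul,
          integral_rpow_mul_integral_rpow (by linarith) (by linarith) hm
            (integrableOn_heatDiff hε hv x)]
        have := integral_Ioi_sub_shift (f := fun t => heatFlow t v x) (ε := ε)
          (fun a b ha hb => intervalIntegrable_heatFlow hv x ha hb) (tendsto_heatFlow_atTop hv x) hε
          (integrableOn_heatDiff hε hv x)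
        unfold heatDiff
        rw [this]
        ring

end RieszPotential

/-! ### Distributional gradients of convolutions -/

section MeanHeatKernel

variable {E : Type*} [NormedAddCommGroup E] [InnerProductSpace ℝ E] [FiniteDimensional ℝ E]
  [MeasurableSpace E] [BorelSpace E] {ε : ℝ} {v : E → ℝ}

/-- The time average `ε⁻¹ ∫₀^ε p_r dr` of the heat kernel. -/
noncomputable def meanHeatKernel (ε : ℝ) (z : E) : ℝ := ε⁻¹ * ∫ r in Ioc 0 ε, heatKernel r z

theorem integrable_heatKernel_prod (ε : ℝ) :
    Integrable (Function.uncurry fun (r : ℝ) (z : E) => heatKernel r z)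
      ((volume.restrict (Ioc 0 ε)).prod volume) := by
  have hm : AEStronglyMeasurable (Function.uncurry fun (r : ℝ) (z : E) => heatKernel r z)
      ((volume.restrict (Ioc 0 ε)).prod volume) :=
    measurable_heatKernel_uncurry.aestronglyMeasurable
  rw [integrable_prod_iff hm]
  constructor
  · exact (ae_restrict_mem measurableSet_Ioc).mono fun r hr => integrable_heatKernel hr.1
  · refine IntegrableOn.congr_fun (f := fun _ => (1 : ℝ))
      (integrableOn_const measure_Ioc_lt_top.ne) (fun r hr => ?_) measurableSet_Ioc
    simp only [Function.uncurry, Real.norm_of_nonneg (heatKernel_pos hr.1 _).le,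
      integral_heatKernel hr.1]

theorem integrable_meanHeatKernel (ε : ℝ) : Integrable (meanHeatKernel ε : E → ℝ) :=
  (integrable_heatKernel_prod ε).integral_prod_right.const_mul _

theorem lintegral_enorm_meanHeatKernel (hε : 0 < ε) :
    ∫⁻ z : E, ‖meanHeatKernel ε z‖ₑ = 1 := by
  have h0 : ∀ z : E, 0 ≤ meanHeatKernel ε z := fun z =>
    mul_nonneg (by positivity) (setIntegral_nonneg measurableSet_Ioc fun r hr =>
      (heatKernel_pos hr.1 z).le)
  simp only [Real.enorm_of_nonneg (h0 _)]
  rw [← ofReal_integral_eq_lintegral_ofReal (integrable_meanHeatKernel ε)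
    (Filter.Eventually.of_forall h0)]
  simp only [meanHeatKernel]
  rw [integral_const_mul, ← integral_integral_swap (integrable_heatKernel_prod ε),
    setIntegral_congr_fun measurableSet_Ioc fun r hr => integral_heatKernel hr.1]
  simp [hε.le, hε.ne']

theorem integral_heatFlow_eq_meanHeatKernel (hε : 0 < ε) (hv : IsTame v) (x : E) :
    ε⁻¹ * ∫ r in (0 : ℝ)..ε, heatFlow r v x = ∫ z, meanHeatKernel ε z * v (x - z) := by
  obtain ⟨M, hM⟩ := hv.bounded
  have hc := hv.continuous
  have hint : Integrable (Function.uncurry fun (r : ℝ) (z : E) => heatKernel r z * v (x - z))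
      ((volume.restrict (Ioc 0 ε)).prod volume) := by
    have h2 : Measurable fun p : ℝ × E => v (x - p.2) := hc.measurable.comp (by fun_prop)
    exact (integrable_heatKernel_prod ε).mul_bdd (c := M) h2.aestronglyMeasurable
      (Filter.Eventually.of_forall fun p => hM _)
  rw [intervalIntegral.integral_of_le hε.le]
  simp only [heatFlow_eq, meanHeatKernel]
  rw [integral_integral_swap hint, ← integral_const_mul]
  simp only [integral_mul_const, mul_assoc]

end MeanHeatKernel

section Gradient

variable {d : ℕ} {v k : EuclideanSpace ℝ (Fin d) → ℝ}
  {Φ : EuclideanSpace ℝ (Fin d) → EuclideanSpace ℝ (Fin d)}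

theorem continuous_gradient (hv : ContDiff ℝ 1 v) : Continuous (gradient v) :=
  (InnerProductSpace.toDual ℝ _).symm.continuous.comp (hv.continuous_fderiv one_ne_zero)

theorem norm_gradient (v : EuclideanSpace ℝ (Fin d) → ℝ) (x : EuclideanSpace ℝ (Fin d)) :
    ‖gradient v x‖ = ‖fderiv ℝ v x‖ := by
  simp [gradient]

theorem continuous_divergence (hΦ : ContDiff ℝ ∞ Φ) : Continuous (divergence Φ) := by
  have : Continuous (fderiv ℝ Φ) := hΦ.continuous_fderiv (by simp)
  unfold divergence
  fun_prop

theorem hasCompactSupport_divergence (hΦ : HasCompactSupport Φ) :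
    HasCompactSupport (divergence Φ) := by
  refine (hΦ.fderiv ℝ).mono' ((Function.support_subset_iff'.2 fun x hx => ?_).trans subset_closure)
  simp only [Function.mem_support, not_not] at hx
  simp [divergence, hx]

/-- Integration by parts against a test field. -/
theorem integral_inner_gradient (hv : ContDiff ℝ 1 v) (hΦ : ContDiff ℝ ∞ Φ)
    (hΦc : HasCompactSupport Φ) :
    ∫ x, inner ℝ (gradient v x) (Φ x) = -∫ x, v x * divergence Φ x := by
  have hcf : Continuous (fderiv ℝ v) := hv.continuous_fderiv one_ne_zero
  have hcΦ : Continuous (fderiv ℝ Φ) := hΦ.continuous_fderiv (by simp)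
  have hc := hv.continuous
  have hcΦ0 := hΦ.continuous
  have hdΦ : Differentiable ℝ Φ := hΦ.differentiable (by simp)
  have hcomp : ∀ i x e, fderiv ℝ (fun y => Φ y i) x e = fderiv ℝ Φ x e i := by
    intro i x e
    have h := ((EuclideanSpace.proj (𝕜 := ℝ) i).hasFDerivAt.comp x (hdΦ x).hasFDerivAt).fderiv
    have h' : fderiv ℝ (fun y => Φ y i) x =
        (EuclideanSpace.proj (𝕜 := ℝ) i).comp (fderiv ℝ Φ x) := h
    rw [h']
    rfl
  have hsupp : ∀ i, HasCompactSupport fun y => Φ y i := fun i =>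
    hΦc.comp_left (g := fun y : EuclideanSpace ℝ (Fin d) => y i) rfl
  have hsupp' : ∀ i, HasCompactSupport fun y => fderiv ℝ Φ y (EuclideanSpace.single i 1) i :=
    fun i => (hΦc.fderiv ℝ).comp_left
      (g := fun L : EuclideanSpace ℝ (Fin d) →L[ℝ] EuclideanSpace ℝ (Fin d) =>
        L (EuclideanSpace.single i 1) i) rfl
  have hi1 : ∀ i, Integrable fun x => fderiv ℝ v x (EuclideanSpace.single i 1) * Φ x i := fun i =>
    Continuous.integrable_of_hasCompactSupport (by fun_prop) (hsupp i).mul_left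
  have hi2 : ∀ i, Integrable fun x => v x * fderiv ℝ Φ x (EuclideanSpace.single i 1) i := fun i =>
    Continuous.integrable_of_hasCompactSupport (by fun_prop) (hsupp' i).mul_left
  have hi3 : ∀ i, Integrable fun x => v x * Φ x i := fun i =>
    Continuous.integrable_of_hasCompactSupport (by fun_prop) (hsupp i).mul_left
  have hibp : ∀ i, ∫ x, fderiv ℝ v x (EuclideanSpace.single i 1) * Φ x i =
      -∫ x, v x * fderiv ℝ Φ x (EuclideanSpace.single i 1) i := by
    intro i
    have h := integral_mul_fderiv_eq_neg_fderiv_mul_of_integrable (𝕜 := ℝ) (μ := volume)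
      (f := v) (g := fun y => Φ y i) (v := EuclideanSpace.single i 1) (hi1 i)
      (by simpa only [hcomp] using hi2 i) (hi3 i)
      (fun x _ => (hv.differentiable one_ne_zero) x) (fun x _ => by fun_prop)
    simp only [hcomp] at h
    rw [h, neg_neg]
  have hinner : ∀ x, inner ℝ (gradient v x) (Φ x) =
      ∑ i, fderiv ℝ v x (EuclideanSpace.single i 1) * Φ x i := by
    intro x
    rw [gradient, InnerProductSpace.toDual_symm_apply]
    conv_lhs => rw [← (EuclideanSpace.basisFun (Fin d) ℝ).sum_repr (Φ x)]
    simp [mul_comm]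
  simp only [hinner, divergence, Finset.mul_sum]
  rw [integral_finsetSum _ fun i _ => hi1 i, integral_finsetSum _ fun i _ => hi2 i,
    ← Finset.sum_neg_distrib]
  exact Finset.sum_congr rfl fun i _ => hibp i

/-- The convolution of an integrable kernel with the gradient of `v`. -/
noncomputable def convGradient (k v : EuclideanSpace ℝ (Fin d) → ℝ)
    (x : EuclideanSpace ℝ (Fin d)) : EuclideanSpace ℝ (Fin d) :=
  ∫ z, k z • gradient v (x - z)

theorem integrable_convGradient_integrand (hk : Integrable k) (hg : Integrable (gradient v)) :
    Integrable (fun p : EuclideanSpace ℝ (Fin d) × EuclideanSpace ℝ (Fin d) =>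
      k p.2 • gradient v (p.1 - p.2)) (volume.prod volume) :=
  Integrable.convolution_integrand (ContinuousLinearMap.lsmul ℝ ℝ) hk hg

theorem integrable_convGradient (hk : Integrable k) (hg : Integrable (gradient v)) :
    Integrable (convGradient k v) :=
  (integrable_convGradient_integrand hk hg).integral_prod_left

theorem lintegral_convGradient_le (hk : Integrable k) (hg : Integrable (gradient v)) :
    ∫⁻ x, ‖convGradient k v x‖ₑ ≤ (∫⁻ z, ‖k z‖ₑ) * ∫⁻ x, ‖gradient v x‖ₑ := by
  calc _ ≤ ∫⁻ x, ∫⁻ z, ‖k z • gradient v (x - z)‖ₑ :=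
        lintegral_mono fun x => enorm_integral_le_lintegral_enorm _
    _ = ∫⁻ z, ∫⁻ x, ‖k z • gradient v (x - z)‖ₑ :=
        lintegral_lintegral_swap (integrable_convGradient_integrand hk hg).1.enorm
    _ = ∫⁻ z, ‖k z‖ₑ * ∫⁻ x, ‖gradient v x‖ₑ := by
        refine lintegral_congr fun z => ?_
        simp only [enorm_smul]
        rw [lintegral_const_mul' _ _ enorm_ne_top,
          lintegral_sub_right_eq_self (fun x => ‖gradient v x‖ₑ) z]
    _ = _ := lintegral_mul_const'' _ hk.1.enorm

theorem gradient_comp_sub (v : EuclideanSpace ℝ (Fin d) → ℝ) (x z : EuclideanSpace ℝ (Fin d)) :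
    gradient (fun y => v (y - z)) x = gradient v (x - z) := by
  rw [gradient, gradient, fderiv_comp_sub]

/-- The distributional gradient of `k * v` is `k * ∇v`. -/
theorem integral_inner_convGradient (hk : Integrable k) (hv : ContDiff ℝ 1 v) (hv' : IsTame v)
    (hg : Integrable (gradient v)) (hΦ : ContDiff ℝ ∞ Φ) (hΦc : HasCompactSupport Φ) :
    ∫ x, inner ℝ (convGradient k v x) (Φ x) =
      -∫ x, (∫ z, k z * v (x - z)) * divergence Φ x := by
  obtain ⟨M, hM⟩ := hv'.bounded
  have hcΦ := hΦ.continuous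
  have hint := integrable_convGradient_integrand hk hg
  obtain ⟨A, hA⟩ := hcΦ.bounded_above_of_compact_support hΦc
  have hint1 : Integrable (Function.uncurry fun x z =>
      (inner ℝ (k z • gradient v (x - z)) (Φ x) : ℝ))
      ((volume : Measure (EuclideanSpace ℝ (Fin d))).prod volume) := by
    refine (hint.norm.mul_const A).mono' (hint.1.inner
      (hcΦ.comp continuous_fst).aestronglyMeasurable) (Filter.Eventually.of_forall fun p => ?_)
    refine (norm_inner_le_norm _ _).trans ?_
    exact mul_le_mul_of_nonneg_left (hA _) (norm_nonneg _)
  have hdiv : Integrable (divergence Φ) :=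
    (continuous_divergence hΦ).integrable_of_hasCompactSupport (hasCompactSupport_divergence hΦc)
  have hint2 : Integrable (Function.uncurry fun z x => k z * (v (x - z) * divergence Φ x))
      ((volume : Measure (EuclideanSpace ℝ (Fin d))).prod volume) := by
    have h := (hk.mul_prod hdiv).bdd_mul (c := M)
      (f := fun p : EuclideanSpace ℝ (Fin d) × EuclideanSpace ℝ (Fin d) => v (p.2 - p.1))
      (hv'.continuous.comp (by fun_prop)).aestronglyMeasurable
      (Filter.Eventually.of_forall fun p => hM _)
    refine h.congr (Filter.Eventually.of_forall fun p => ?_)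
    simp only [Function.uncurry]
    ring
  calc ∫ x, inner ℝ (convGradient k v x) (Φ x)
      = ∫ x, ∫ z, inner ℝ (k z • gradient v (x - z)) (Φ x) := by
        refine integral_congr_ae ?_
        filter_upwards [hint.prod_right_ae] with x hx
        rw [real_inner_comm, convGradient, ← integral_inner hx]
        exact integral_congr_ae (Filter.Eventually.of_forall fun z => real_inner_comm _ _)
    _ = ∫ z, ∫ x, inner ℝ (k z • gradient v (x - z)) (Φ x) := integral_integral_swap hint1
    _ = -∫ z, ∫ x, k z * (v (x - z) * divergence Φ x) := by
        rw [← integral_neg]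
        refine integral_congr_ae (Filter.Eventually.of_forall fun z => ?_)
        simp only [real_inner_smul_left]
        have hvz : ContDiff ℝ 1 fun y => v (y - z) := hv.comp (contDiff_id.sub contDiff_const)
        have h := integral_inner_gradient hvz hΦ hΦc
        simp only [gradient_comp_sub] at h
        rw [integral_const_mul, integral_const_mul, h, mul_neg]
    _ = -∫ x, ∫ z, k z * (v (x - z) * divergence Φ x) := by rw [integral_integral_swap hint2]
    _ = _ := by simp only [← mul_assoc, integral_mul_const]

end Gradient

/-! ### The one-dimensional jump profile -/

section Profile

theorem heatKernel_real (t x : ℝ) :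
    heatKernel t x = (4 * Real.pi * t) ^ (-(1 / 2) : ℝ) * Real.exp (-(x ^ 2 / (4 * t))) := by
  simp [heatKernel]

/-- The absolute moments `∫ |x|^p p_1(x) dx` of the one-dimensional heat kernel at time `1`. -/
noncomputable def heatMoment (p : ℝ) : ℝ := ∫ x : ℝ, |x| ^ p * heatKernel 1 x

theorem integrable_abs_rpow_mul_heatKernel {p t : ℝ} (hp : 0 < p) (ht : 0 < t) :
    Integrable fun x : ℝ => |x| ^ p * heatKernel t x := by
  have h1 := (integrable_rpow_mul_exp_neg_mul_sq (b := 1 / (4 * t)) (by positivity)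
    (s := p) (by linarith)).norm.const_mul ((4 * Real.pi * t) ^ (-(1 / 2) : ℝ))
  have h2 := h1.comp_neg
  have hm : Measurable fun x : ℝ => |x| ^ p * heatKernel t x := by unfold heatKernel; fun_prop
  refine (h1.add h2).mono' hm.aestronglyMeasurable (Filter.Eventually.of_forall fun x => ?_)
  have he : -(1 / (4 * t)) * x ^ 2 = -(x ^ 2 / (4 * t)) := by ring
  simp only [heatKernel_real, norm_mul, Pi.add_apply, neg_sq, Real.norm_eq_abs, Real.abs_exp, he]
  rw [abs_of_pos (Real.rpow_pos_of_pos (by positivity : 0 < 4 * Real.pi * t) _),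
    abs_of_nonneg (Real.rpow_nonneg (abs_nonneg x) p)]
  have hc : 0 < (4 * Real.pi * t) ^ (-(1 / 2) : ℝ) := by positivity
  rcases le_total 0 x with hx | hx
  · rw [abs_of_nonneg hx, abs_of_nonneg (Real.rpow_nonneg hx p)]
    have : 0 ≤ (4 * Real.pi * t) ^ (-(1 / 2) : ℝ) * (|(-x) ^ p| * Real.exp (-(x ^ 2 / (4 * t)))) := by
      positivity
    nlinarith
  · rw [abs_of_nonpos hx, abs_of_nonneg (Real.rpow_nonneg (neg_nonneg.2 hx) p)]
    have : 0 ≤ (4 * Real.pi * t) ^ (-(1 / 2) : ℝ) * (|x ^ p| * Real.exp (-(x ^ 2 / (4 * t)))) := by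
      positivity
    nlinarith

theorem heatKernel_real_scale {t : ℝ} (ht : 0 < t) (x : ℝ) :
    heatKernel t (t ^ (1 / 2 : ℝ) * x) = (t ^ (1 / 2 : ℝ))⁻¹ * heatKernel 1 x := by
  have h1 : (t ^ (1 / 2 : ℝ)) ^ 2 = t := by
    rw [← Real.rpow_natCast, ← Real.rpow_mul ht.le]; norm_num
  rw [heatKernel_real, heatKernel_real, mul_pow, h1, mul_one, Real.mul_rpow (by positivity) ht.le,
    ← Real.rpow_neg ht.le]
  rw [show t * x ^ 2 / (4 * t) = x ^ 2 / (4 * 1) by field_simp]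
  ring

theorem integral_abs_rpow_mul_heatKernel (p : ℝ) {t : ℝ} (ht : 0 < t) :
    ∫ x : ℝ, |x| ^ p * heatKernel t x = heatMoment p * t ^ (p / 2) := by
  have hr : 0 < t ^ (1 / 2 : ℝ) := by positivity
  have h := Measure.integral_comp_mul_left (fun x : ℝ => |x| ^ p * heatKernel t x) (t ^ (1 / 2 : ℝ))
  have h2 : ∀ x : ℝ, |t ^ (1 / 2 : ℝ) * x| ^ p * heatKernel t (t ^ (1 / 2 : ℝ) * x) =
      ((t ^ (1 / 2 : ℝ))⁻¹ * t ^ (p / 2)) * (|x| ^ p * heatKernel 1 x) := by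
    intro x
    rw [heatKernel_real_scale ht, abs_mul, abs_of_pos hr, Real.mul_rpow hr.le (abs_nonneg _),
      ← Real.rpow_mul ht.le, show 1 / 2 * p = p / 2 by ring]
    ring
  simp only [h2] at h
  rw [integral_const_mul, smul_eq_mul, abs_of_pos (inv_pos.2 hr), mul_assoc] at h
  rw [← mul_left_cancel₀ (inv_ne_zero hr.ne') h, heatMoment, mul_comm]

theorem heatMoment_pos {p : ℝ} (hp : 0 < p) : 0 < heatMoment p := by
  unfold heatMoment
  rw [integral_pos_iff_support_of_nonneg
    (fun x => mul_nonneg (by positivity) (heatKernel_pos one_pos x).le)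
    (integrable_abs_rpow_mul_heatKernel hp one_pos)]
  refine lt_of_lt_of_le ?_ (measure_mono (s := Ioi (0 : ℝ)) fun x (hx : 0 < x) => ?_)
  · simp
  · exact (mul_pos (by positivity) (heatKernel_pos one_pos x)).ne'

/-- Minus the derivative of the one-dimensional heat kernel. -/
noncomputable def heatDipole (τ x : ℝ) : ℝ := x / (2 * τ) * heatKernel τ x

theorem measurable_heatDipole_uncurry : Measurable fun p : ℝ × ℝ => heatDipole p.1 p.2 := by
  unfold heatDipole heatKernel; fun_prop

theorem abs_heatDipole {τ : ℝ} (hτ : 0 < τ) (x : ℝ) :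
    |heatDipole τ x| = (2 * τ)⁻¹ * (|x| ^ (1 : ℝ) * heatKernel τ x) := by
  rw [heatDipole, abs_mul, abs_div, abs_of_pos (heatKernel_pos hτ x),
    abs_of_pos (by positivity : 0 < 2 * τ), Real.rpow_one]
  ring

theorem integrable_heatDipole {τ : ℝ} (hτ : 0 < τ) : Integrable (heatDipole τ) := by
  have hm : Measurable (heatDipole τ) := measurable_heatDipole_uncurry.comp
    (g := fun p : ℝ × ℝ => heatDipole p.1 p.2) (f := fun x => (τ, x)) (by fun_prop)
  refine ((integrable_abs_rpow_mul_heatKernel one_pos hτ).const_mul (2 * τ)⁻¹).mono'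
    hm.aestronglyMeasurable (Filter.Eventually.of_forall fun x => ?_)
  rw [Real.norm_eq_abs, abs_heatDipole hτ]

theorem integral_abs_heatDipole {τ : ℝ} (hτ : 0 < τ) :
    ∫ x, |heatDipole τ x| = heatMoment 1 / 2 * τ ^ (-(1 / 2) : ℝ) := by
  simp only [abs_heatDipole hτ]
  rw [integral_const_mul, integral_abs_rpow_mul_heatKernel 1 hτ,
    show (-(1 / 2) : ℝ) = 1 / 2 - 1 by norm_num, Real.rpow_sub_one hτ.ne']
  field_simp

theorem integrable_id_mul_heatKernel {τ : ℝ} (hτ : 0 < τ) :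
    Integrable fun y : ℝ => y * heatKernel τ y := by
  refine ((integrable_heatDipole hτ).const_mul (2 * τ)).congr
    (Filter.Eventually.of_forall fun y => ?_)
  simp only [heatDipole]
  field_simp

theorem integral_id_mul_heatKernel (τ : ℝ) : ∫ y : ℝ, y * heatKernel τ y = 0 := by
  have h := integral_neg_eq_self (fun y : ℝ => y * heatKernel τ y) volume
  simp only [heatKernel_neg, neg_mul, integral_neg] at h
  linarith

theorem integral_id_mul_heatKernel_sub {τ : ℝ} (hτ : 0 < τ) (m : ℝ) :
    ∫ y : ℝ, y * heatKernel τ (y - m) = m := by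
  have h := integral_sub_right_eq_self (fun y : ℝ => (y + m) * heatKernel τ y) (μ := volume) m
  simp only [sub_add_cancel] at h
  rw [h]
  simp only [add_mul]
  rw [integral_add (integrable_id_mul_heatKernel hτ) ((integrable_heatKernel hτ).const_mul m),
    integral_id_mul_heatKernel, integral_const_mul, integral_heatKernel hτ]
  ring

theorem heatFlow_heatDipole {t τ : ℝ} (ht : 0 < t) (hτ : 0 < τ) (x : ℝ) :
    heatFlow t (heatDipole τ) x = heatDipole (t + τ) x := by
  have hs : 0 < t + τ := by positivity
  have h : ∀ y, heatKernel t (x - y) * heatDipole τ y = ((2 * τ)⁻¹ * heatKernel (t + τ) x) *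
      (y * heatKernel (t * τ / (t + τ)) (y - τ / (t + τ) * x)) := by
    intro y
    have := heatKernel_mul_heatKernel ht hτ x y 0
    simp only [sub_zero, smul_eq_mul, mul_zero, add_zero] at this
    rw [heatDipole]
    linear_combination (y / (2 * τ)) * this
  unfold heatFlow
  simp only [h]
  rw [integral_const_mul, integral_id_mul_heatKernel_sub (by positivity), heatDipole]
  field_simp

/-- A smooth odd profile with a jump of unit size at the origin, smoothed at the spatial scale
`√ε`; it is `Φ_ε - Φ_1` with `Φ_τ` the distribution function of the heat kernel at time `τ`. -/
noncomputable def jumpProfile (ε x : ℝ) : ℝ := ∫ τ in ε..1, heatDipole τ x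

/-- The antiderivative of the heat kernel at time `1`. -/
noncomputable def heatPrimitive (x : ℝ) : ℝ := ∫ s in (0 : ℝ)..x, heatKernel 1 s

theorem hasDerivAt_heatPrimitive (x : ℝ) : HasDerivAt heatPrimitive (heatKernel 1 x) x := by
  have hc := continuous_heatKernel (E := ℝ) 1
  exact intervalIntegral.integral_hasDerivAt_right (hc.intervalIntegrable _ _)
    (hc.stronglyMeasurableAtFilter _ _) hc.continuousAt

theorem abs_heatPrimitive_le (x : ℝ) : |heatPrimitive x| ≤ 1 := by
  unfold heatPrimitive
  refine le_of_le_of_eq ?_ (integral_heatKernel (E := ℝ) one_pos)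
  refine (intervalIntegral.norm_integral_le_integral_norm_uIoc (f := heatKernel (E := ℝ) 1)
    (μ := volume) (a := 0) (b := x)).trans ?_
  simp only [Real.norm_of_nonneg (heatKernel_pos one_pos _).le]
  exact setIntegral_le_integral (integrable_heatKernel one_pos)
    (Filter.Eventually.of_forall fun x => (heatKernel_pos one_pos x).le)

variable {ε : ℝ}

theorem heatKernel_real_eq_scale {t : ℝ} (ht : 0 < t) (x : ℝ) :
    heatKernel t x = t ^ (-(1 / 2) : ℝ) * heatKernel 1 (t ^ (-(1 / 2) : ℝ) * x) := by
  have h := heatKernel_real_scale ht (t ^ (-(1 / 2) : ℝ) * x)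
  rw [← mul_assoc, ← Real.rpow_add ht] at h
  rw [Real.rpow_neg ht.le] at h ⊢
  simpa using h

theorem jumpProfile_eq (hε : 0 < ε) (x : ℝ) :
    jumpProfile ε x = heatPrimitive (ε ^ (-(1 / 2) : ℝ) * x) - heatPrimitive x := by
  have hpos : ∀ τ ∈ uIcc ε 1, 0 < τ := fun τ hτ => (lt_min hε one_pos).trans_le hτ.1
  -- `p_τ(x) = τ^{-1/2} p_1(τ^{-1/2} x)`, so the integrand is a derivative in `τ`
  have hder : ∀ τ ∈ uIcc ε 1,
      HasDerivAt (fun τ : ℝ => -heatPrimitive (τ ^ (-(1 / 2) : ℝ) * x)) (heatDipole τ x) τ := by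
    intro τ hτ
    have hτ0 := hpos τ hτ
    have h1 := ((Real.hasDerivAt_rpow_const (x := τ) (p := -(1 / 2)) (Or.inl hτ0.ne')).mul_const x)
    refine ((hasDerivAt_heatPrimitive _).comp τ h1).neg.congr_deriv ?_
    rw [heatDipole, heatKernel_real_eq_scale hτ0, Real.rpow_sub_one hτ0.ne']
    field_simp
  have hcont : ContinuousOn (fun τ => heatDipole τ x) (uIcc ε 1) := by
    intro τ hτ
    have hτ0 := hpos τ hτ
    have h4 : 4 * Real.pi * τ ≠ 0 := by positivity
    have h5 : 4 * τ ≠ 0 := by positivity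
    have h6 : 2 * τ ≠ 0 := by positivity
    refine ContinuousAt.continuousWithinAt ?_
    unfold heatDipole heatKernel
    refine (continuousAt_const.div (by fun_prop) h6).mul (ContinuousAt.mul ?_ ?_)
    · exact ContinuousAt.rpow_const (by fun_prop) (Or.inl h4)
    · exact (ContinuousAt.neg (continuousAt_const.div (by fun_prop) h5)).rexp
  rw [jumpProfile, intervalIntegral.integral_eq_sub_of_hasDerivAt hder hcont.intervalIntegrable]
  simp
  ring

theorem hasDerivAt_jumpProfile (hε : 0 < ε) (x : ℝ) :
    HasDerivAt (jumpProfile ε) (heatKernel ε x - heatKernel 1 x) x := by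
  have h : jumpProfile ε = fun x => heatPrimitive (ε ^ (-(1 / 2) : ℝ) * x) - heatPrimitive x :=
    funext (jumpProfile_eq hε)
  rw [h, heatKernel_real_eq_scale hε]
  refine HasDerivAt.sub ?_ (hasDerivAt_heatPrimitive x)
  have h1 : HasDerivAt (fun x : ℝ => ε ^ (-(1 / 2) : ℝ) * x) (ε ^ (-(1 / 2) : ℝ)) x := by
    simpa using (hasDerivAt_id x).const_mul (ε ^ (-(1 / 2) : ℝ))
  refine ((hasDerivAt_heatPrimitive _).comp x h1).congr_deriv ?_
  ring

theorem contDiff_jumpProfile (hε : 0 < ε) : ContDiff ℝ 1 (jumpProfile ε) := by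
  rw [contDiff_one_iff_deriv]
  refine ⟨fun x => (hasDerivAt_jumpProfile hε x).differentiableAt, ?_⟩
  rw [funext fun x => (hasDerivAt_jumpProfile hε x).deriv]
  exact (continuous_heatKernel ε).sub (continuous_heatKernel 1)

theorem lintegral_deriv_jumpProfile_le (hε : 0 < ε) :
    ∫⁻ x, ‖deriv (jumpProfile ε) x‖ₑ ≤ 2 := by
  have h1 : ∀ t : ℝ, 0 < t → ∫⁻ x : ℝ, ‖heatKernel t x‖ₑ = 1 := by
    intro t ht
    simp only [Real.enorm_of_nonneg (heatKernel_pos ht _).le]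
    rw [← ofReal_integral_eq_lintegral_ofReal (integrable_heatKernel ht)
      (Filter.Eventually.of_forall fun x => (heatKernel_pos ht x).le), integral_heatKernel ht]
    simp
  calc _ ≤ ∫⁻ x : ℝ, (‖heatKernel ε x‖ₑ + ‖heatKernel 1 x‖ₑ) := by
        refine lintegral_mono fun x => ?_
        rw [(hasDerivAt_jumpProfile hε x).deriv]
        exact enorm_sub_le
    _ = 2 := by
        rw [lintegral_add_left (continuous_heatKernel ε).measurable.enorm, h1 ε hε, h1 1 one_pos]
        norm_num

theorem integrable_heatDipole_prod (hε : 0 < ε) :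
    Integrable (Function.uncurry fun τ x : ℝ => heatDipole τ x)
      ((volume.restrict (Ioc ε 1)).prod volume) := by
  have hm : AEStronglyMeasurable (Function.uncurry fun τ x : ℝ => heatDipole τ x)
      ((volume.restrict (Ioc ε 1)).prod volume) :=
    measurable_heatDipole_uncurry.aestronglyMeasurable
  rw [integrable_prod_iff hm]
  constructor
  · exact (ae_restrict_mem measurableSet_Ioc).mono fun τ hτ =>
      integrable_heatDipole (hε.trans hτ.1)
  · have h : IntegrableOn (fun τ : ℝ => heatMoment 1 / 2 * τ ^ (-(1 / 2) : ℝ)) (Ioc 0 1) :=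
      ((intervalIntegrable_iff_integrableOn_Ioc_of_le zero_le_one).1
        (intervalIntegral.intervalIntegrable_rpow' (by norm_num))).const_mul _
    refine IntegrableOn.congr_fun (h.mono_set (Ioc_subset_Ioc_left hε.le)) (fun τ hτ => ?_)
      measurableSet_Ioc
    exact (integral_abs_heatDipole (hε.trans hτ.1)).symm

theorem jumpProfile_eq_setIntegral (hε1 : ε ≤ 1) (x : ℝ) :
    jumpProfile ε x = ∫ τ in Ioc ε 1, heatDipole τ x :=
  intervalIntegral.integral_of_le hε1

theorem isTame_jumpProfile (hε : 0 < ε) (hε1 : ε ≤ 1) : IsTame (jumpProfile ε) where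
  continuous := (contDiff_jumpProfile hε).continuous
  integrable := by
    rw [funext (jumpProfile_eq_setIntegral hε1)]
    exact (integrable_heatDipole_prod hε).integral_prod_right
  bounded := by
    refine ⟨2, fun x => ?_⟩
    rw [jumpProfile_eq hε]
    refine (abs_sub _ _).trans ?_
    linarith [abs_heatPrimitive_le (ε ^ (-(1 / 2) : ℝ) * x), abs_heatPrimitive_le x]

theorem lintegral_jumpProfile_le (hε : 0 < ε) (hε1 : ε ≤ 1) :
    ∫⁻ x, ‖jumpProfile ε x‖ₑ ≤ ENNReal.ofReal (heatMoment 1) := by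
  have hm : Measurable (Function.uncurry fun x τ : ℝ => ‖heatDipole τ x‖ₑ) :=
    (measurable_heatDipole_uncurry.comp measurable_swap).enorm
  have h : IntegrableOn (fun τ : ℝ => heatMoment 1 / 2 * τ ^ (-(1 / 2) : ℝ)) (Ioc 0 1) :=
    ((intervalIntegrable_iff_integrableOn_Ioc_of_le zero_le_one).1
      (intervalIntegral.intervalIntegrable_rpow' (by norm_num))).const_mul _
  calc ∫⁻ x, ‖jumpProfile ε x‖ₑ ≤ ∫⁻ x, ∫⁻ τ in Ioc ε 1, ‖heatDipole τ x‖ₑ := by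
        refine lintegral_mono fun x => ?_
        rw [jumpProfile_eq_setIntegral hε1]
        exact enorm_integral_le_lintegral_enorm _
    _ = ∫⁻ τ in Ioc ε 1, ∫⁻ x, ‖heatDipole τ x‖ₑ := lintegral_lintegral_swap hm.aemeasurable
    _ = ∫⁻ τ in Ioc ε 1, ENNReal.ofReal (heatMoment 1 / 2 * τ ^ (-(1 / 2) : ℝ)) := by
        refine setLIntegral_congr_fun measurableSet_Ioc fun τ hτ => ?_
        have hτ0 := hε.trans hτ.1
        simp only [Real.enorm_eq_ofReal_abs]
        rw [← ofReal_integral_eq_lintegral_ofReal (integrable_heatDipole hτ0).abs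
          (Filter.Eventually.of_forall fun _ => abs_nonneg _), integral_abs_heatDipole hτ0]
    _ ≤ ∫⁻ τ in Ioc 0 1, ENNReal.ofReal (heatMoment 1 / 2 * τ ^ (-(1 / 2) : ℝ)) :=
        lintegral_mono_set (Ioc_subset_Ioc_left hε.le)
    _ = ENNReal.ofReal (heatMoment 1) := by
        rw [← ofReal_integral_eq_lintegral_ofReal h
          ((ae_restrict_mem measurableSet_Ioc).mono fun τ hτ => by
            have := heatMoment_pos one_pos
            have := hτ.1
            simp only [Pi.zero_apply]
            positivity), integral_const_mul, ← intervalIntegral.integral_of_le zero_le_one,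
          integral_rpow (Or.inl (by norm_num))]
        norm_num

theorem heatFlow_jumpProfile (hε : 0 < ε) (hε1 : ε ≤ 1) {t : ℝ} (ht : 0 < t) (x : ℝ) :
    heatFlow t (jumpProfile ε) x = ∫ τ in Ioc ε 1, heatDipole (t + τ) x := by
  have hint : Integrable (Function.uncurry fun τ y : ℝ => heatKernel t (x - y) * heatDipole τ y)
      ((volume.restrict (Ioc ε 1)).prod volume) := by
    refine (integrable_heatDipole_prod hε).bdd_mul
      (c := (4 * Real.pi * t) ^ (-((Module.finrank ℝ ℝ : ℝ) / 2)))
      ((continuous_heatKernel t).comp (f := fun p : ℝ × ℝ => x - p.2)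
        (by fun_prop)).aestronglyMeasurable (Filter.Eventually.of_forall fun p => ?_)
    rw [Real.norm_of_nonneg (heatKernel_pos ht _).le]
    exact heatKernel_le ht _
  unfold heatFlow
  simp only [jumpProfile_eq_setIntegral hε1, ← integral_const_mul]
  rw [← integral_integral_swap hint]
  exact setIntegral_congr_fun measurableSet_Ioc fun τ hτ =>
    heatFlow_heatDipole ht (hε.trans hτ.1) x

/-- The odd function `sgn(x) |x|^{-α}`, with value `0` at the origin. -/
noncomputable def oddPower (α x : ℝ) : ℝ := SignType.sign x * |x| ^ (-α)

theorem measurable_oddPower (α : ℝ) : Measurable (oddPower α) := by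
  have h : oddPower α = fun x => if 0 < x then |x| ^ (-α) else if x < 0 then -|x| ^ (-α) else 0 := by
    funext x
    simp only [oddPower, sign_apply]
    split_ifs <;> simp
  rw [h]
  exact Measurable.ite measurableSet_Ioi (by fun_prop)
    (Measurable.ite measurableSet_Iio (by fun_prop) measurable_const)

variable {α : ℝ}

theorem abs_oddPower_le (α x : ℝ) : |oddPower α x| ≤ |x| ^ (-α) := by
  rw [oddPower, abs_mul, abs_of_nonneg (Real.rpow_nonneg (abs_nonneg x) (-α))]
  refine mul_le_of_le_one_left (by positivity) ?_
  rcases lt_trichotomy x 0 with h | h | h <;> simp [h]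

theorem oddPower_mul_heatDipole (hα1 : α < 1) (τ x : ℝ) :
    oddPower α x * heatDipole τ x = (2 * τ)⁻¹ * (|x| ^ (1 - α) * heatKernel τ x) := by
  rcases eq_or_ne x 0 with rfl | hx
  · rw [heatDipole, abs_zero, Real.zero_rpow (by linarith)]
    ring
  · rw [oddPower, heatDipole, sub_eq_add_neg, Real.rpow_add (abs_pos.2 hx), Real.rpow_one,
      ← sign_mul_self x]
    ring

theorem integral_oddPower_mul_heatDipole (hα1 : α < 1) {τ : ℝ} (hτ : 0 < τ) :
    ∫ x, oddPower α x * heatDipole τ x =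
      heatMoment (1 - α) / 2 * τ ^ (-(1 - (1 - α) / 2)) := by
  simp only [oddPower_mul_heatDipole hα1]
  rw [integral_const_mul, integral_abs_rpow_mul_heatKernel _ hτ,
    show -(1 - (1 - α) / 2) = (1 - α) / 2 - 1 by ring, Real.rpow_sub_one hτ.ne']
  field_simp

/-- The pairing of `P_t V` with `sgn(x) |x|^{-α}` for the jump profile `V`, obtained from the
semigroup law `P_t (-p_τ') = -p_{t+τ}'` and the moments of the heat kernel. -/
theorem integral_oddPower_mul_heatFlow (hα1 : α < 1) (hε : 0 < ε) (hε1 : ε ≤ 1) {t : ℝ}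
    (ht : 0 < t) : ∫ x, oddPower α x * heatFlow t (jumpProfile ε) x =
      heatMoment (1 - α) / 2 * ∫ τ in ε..1, (t + τ) ^ (-(1 - (1 - α) / 2)) := by
  have hm : Measurable (Function.uncurry fun τ x : ℝ => oddPower α x * heatDipole (t + τ) x) := by
    have h1 : Measurable fun p : ℝ × ℝ => heatDipole (t + p.1) p.2 :=
      measurable_heatDipole_uncurry.comp (g := fun p : ℝ × ℝ => heatDipole p.1 p.2)
        (f := fun p : ℝ × ℝ => (t + p.1, p.2)) (by fun_prop)
    exact ((measurable_oddPower α).comp measurable_snd).mul h1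
  have hnn : ∀ τ > 0, ∀ x, 0 ≤ oddPower α x * heatDipole τ x := by
    intro τ hτ x
    rw [oddPower_mul_heatDipole hα1]
    have := heatKernel_pos hτ x
    positivity
  have hcont : ContinuousOn (fun τ : ℝ => heatMoment (1 - α) / 2 *
      (t + τ) ^ (-(1 - (1 - α) / 2))) (Icc ε 1) := by
    refine continuousOn_const.mul (ContinuousOn.rpow_const (by fun_prop) fun τ hτ => Or.inl ?_)
    linarith [hτ.1]
  have hint : Integrable (Function.uncurry fun τ x : ℝ => oddPower α x * heatDipole (t + τ) x)
      ((volume.restrict (Ioc ε 1)).prod volume) := by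
    rw [integrable_prod_iff hm.aestronglyMeasurable]
    constructor
    · refine (ae_restrict_mem measurableSet_Ioc).mono fun τ hτ => ?_
      have hτ0 : 0 < t + τ := by linarith [hτ.1]
      simp only [Function.uncurry, oddPower_mul_heatDipole hα1]
      exact (integrable_abs_rpow_mul_heatKernel (by linarith) hτ0).const_mul _
    · refine IntegrableOn.congr_fun (hcont.integrableOn_Icc.mono_set Ioc_subset_Icc_self)
        (fun τ hτ => ?_) measurableSet_Ioc
      have hτ0 : 0 < t + τ := by linarith [hτ.1]
      simp only [Function.uncurry, Real.norm_of_nonneg (hnn _ hτ0 _)]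
      exact (integral_oddPower_mul_heatDipole hα1 hτ0).symm
  simp only [heatFlow_jumpProfile hε hε1 ht, ← integral_const_mul]
  rw [← integral_integral_swap hint, ← intervalIntegral.integral_const_mul,
    intervalIntegral.integral_of_le hε1]
  refine setIntegral_congr_fun measurableSet_Ioc fun τ hτ => ?_
  exact integral_oddPower_mul_heatDipole hα1 (by linarith [hτ.1])

end Profile

/-! ### Logarithmic growth -/

section Growth

variable {η ε : ℝ}

theorem intervalIntegrable_rpow_neg_of_pos {a b : ℝ} (ha : 0 < a) (hb : 0 < b) :
    IntervalIntegrable (fun τ : ℝ => τ ^ (-η)) volume a b :=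
  intervalIntegral.intervalIntegrable_rpow (Or.inr fun h => by
    have := (lt_min ha hb).trans_le h.1
    exact lt_irrefl _ this)

/-- The two integrals over `[t + ε, t + 1]` and `[t + 2ε, t + 1 + ε]` differ only by the two end
pieces of length `ε`. -/
theorem le_integral_rpow_sub_integral_rpow (hη : 0 < η) (hε : 0 < ε) {t : ℝ} (ht : 0 < t) :
    ε * ((t + 2 * ε) ^ (-η) - (t + 1) ^ (-η)) ≤
      (∫ τ in ε..1, (t + τ) ^ (-η)) - ∫ τ in ε..1, (t + ε + τ) ^ (-η) := by
  rw [intervalIntegral.integral_comp_add_left (fun τ => τ ^ (-η)),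
    intervalIntegral.integral_comp_add_left (fun τ => τ ^ (-η))]
  have hI : ∀ {a b : ℝ}, 0 < a → 0 < b → IntervalIntegrable (fun τ : ℝ => τ ^ (-η)) volume a b :=
    fun ha hb => intervalIntegrable_rpow_neg_of_pos ha hb
  have e1 := intervalIntegral.integral_add_adjacent_intervals
    (hI (by positivity : 0 < t + ε) (by positivity : 0 < t + ε + ε))
    (hI (by positivity : 0 < t + ε + ε) (by positivity : 0 < t + ε + 1))
  have e2 := intervalIntegral.integral_add_adjacent_intervals
    (hI (by positivity : 0 < t + ε) (by positivity : 0 < t + 1))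
    (hI (by positivity : 0 < t + 1) (by positivity : 0 < t + ε + 1))
  have l1 : ε * (t + 2 * ε) ^ (-η) ≤ ∫ τ in (t + ε)..(t + ε + ε), τ ^ (-η) := by
    have := intervalIntegral.integral_mono_on (by linarith : t + ε ≤ t + ε + ε)
      (intervalIntegrable_const (c := (t + 2 * ε) ^ (-η)))
      (hI (by positivity) (by positivity)) fun τ hτ =>
        Real.rpow_le_rpow_of_nonpos (by linarith [hτ.1] : 0 < τ)
          (by linarith [hτ.2] : τ ≤ t + 2 * ε) (by linarith : -η ≤ 0)
    rw [intervalIntegral.integral_const, smul_eq_mul] at this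
    linarith
  have l2 : ∫ τ in (t + 1)..(t + ε + 1), τ ^ (-η) ≤ ε * (t + 1) ^ (-η) := by
    have := intervalIntegral.integral_mono_on (by linarith : t + 1 ≤ t + ε + 1)
      (hI (by positivity) (by positivity))
      (intervalIntegrable_const (c := (t + 1) ^ (-η))) fun τ hτ =>
        Real.rpow_le_rpow_of_nonpos (by positivity : 0 < t + 1) hτ.1 (by linarith : -η ≤ 0)
    rw [intervalIntegral.integral_const, smul_eq_mul] at this
    linarith
  linarith

theorem integral_rpow_sub_integral_rpow_nonneg (hη : 0 < η) (hε : 0 < ε) (hε1 : ε ≤ 1) {t : ℝ}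
    (ht : 0 < t) :
    0 ≤ (∫ τ in ε..1, (t + τ) ^ (-η)) - ∫ τ in ε..1, (t + ε + τ) ^ (-η) := by
  rw [sub_nonneg]
  have hI : ∀ t : ℝ, 0 < t → IntervalIntegrable (fun τ : ℝ => (t + τ) ^ (-η)) volume ε 1 := by
    intro t ht
    refine ContinuousOn.intervalIntegrable_of_Icc hε1 ?_
    refine ContinuousOn.rpow_const (by fun_prop) fun τ hτ => Or.inl ?_
    linarith [hτ.1]
  refine intervalIntegral.integral_mono_on hε1 (hI _ (by positivity)) (hI _ ht) fun τ hτ => ?_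
  exact Real.rpow_le_rpow_of_nonpos (by linarith [hτ.1]) (by linarith) (by linarith)

/-- On `[ε, 1]` the integrand is at least `t^{η-1} ((3t)^{-η} - 1)`, which produces the
logarithm. -/
theorem log_le_integral_rpow_mul_sub (hη : 0 < η) (hε : 0 < ε) (hε1 : ε ≤ 1)
    (hint : IntegrableOn (fun t => t ^ (-(1 - η)) * ((∫ τ in ε..1, (t + τ) ^ (-η)) -
      ∫ τ in ε..1, (t + ε + τ) ^ (-η))) (Ioi 0)) :
    3 ^ (-η) * Real.log (1 / ε) - 1 / η ≤
      ε⁻¹ * ∫ t in Ioi (0 : ℝ), t ^ (-(1 - η)) * ((∫ τ in ε..1, (t + τ) ^ (-η)) -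
        ∫ τ in ε..1, (t + ε + τ) ^ (-η)) := by
  set F : ℝ → ℝ := fun t => t ^ (-(1 - η)) * ((∫ τ in ε..1, (t + τ) ^ (-η)) -
        ∫ τ in ε..1, (t + ε + τ) ^ (-η)) with hF
  have h1 : ∫ t in Ioc ε 1, F t ≤ ∫ t in Ioi (0 : ℝ), F t := by
    refine setIntegral_mono_set hint ((ae_restrict_mem measurableSet_Ioi).mono fun t ht => ?_)
      (Filter.Eventually.of_forall fun t ht => hε.trans ht.1)
    have ht0 : 0 < t := ht
    exact mul_nonneg (by positivity) (integral_rpow_sub_integral_rpow_nonneg hη hε hε1 ht0)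
  have hi1 : IntervalIntegrable (fun t : ℝ => t ^ (-1 : ℝ)) volume ε 1 :=
    intervalIntegrable_rpow_neg_of_pos hε one_pos
  have hi2 : IntervalIntegrable (fun t : ℝ => t ^ (η - 1)) volume ε 1 :=
    intervalIntegral.intervalIntegrable_rpow' (by linarith)
  have h2 : ∫ t in ε..1, ε * (3 ^ (-η) * t ^ (-1 : ℝ) - t ^ (η - 1)) ≤ ∫ t in Ioc ε 1, F t := by
    rw [← intervalIntegral.integral_of_le hε1]
    refine intervalIntegral.integral_mono_on hε1 (((hi1.const_mul _).sub hi2).const_mul _)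
      ((intervalIntegrable_iff_integrableOn_Ioc_of_le hε1).2
        (hint.mono_set fun t ht => hε.trans ht.1)) fun t ht => ?_
    have ht0 : 0 < t := hε.trans_le ht.1
    have e1 : t ^ (-(1 - η)) * (3 * t) ^ (-η) = 3 ^ (-η) * t ^ (-1 : ℝ) := by
      rw [Real.mul_rpow (by norm_num) ht0.le, mul_left_comm, ← Real.rpow_add ht0]
      congr 2
      ring
    have e2 : (3 * t) ^ (-η) ≤ (t + 2 * ε) ^ (-η) :=
      Real.rpow_le_rpow_of_nonpos (by positivity) (by linarith [ht.1]) (by linarith)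
    have e3 : (t + 1) ^ (-η) ≤ 1 := Real.rpow_le_one_of_one_le_of_nonpos (by linarith) (by linarith)
    calc ε * (3 ^ (-η) * t ^ (-1 : ℝ) - t ^ (η - 1))
        = t ^ (-(1 - η)) * (ε * ((3 * t) ^ (-η) - 1)) := by
          rw [← e1, show -(1 - η) = η - 1 by ring]; ring
      _ ≤ t ^ (-(1 - η)) * (ε * ((t + 2 * ε) ^ (-η) - (t + 1) ^ (-η))) := by gcongr
      _ ≤ F t := by
          rw [hF]
          exact mul_le_mul_of_nonneg_left (le_integral_rpow_sub_integral_rpow hη hε ht0)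
            (by positivity)
  have h3 : ∫ t in ε..1, ε * (3 ^ (-η) * t ^ (-1 : ℝ) - t ^ (η - 1)) =
      ε * (3 ^ (-η) * Real.log (1 / ε) - (1 - ε ^ η) / η) := by
    rw [intervalIntegral.integral_const_mul, intervalIntegral.integral_sub (hi1.const_mul _) hi2,
      intervalIntegral.integral_const_mul]
    simp only [Real.rpow_neg_one]
    rw [integral_inv_of_pos hε one_pos, integral_rpow (Or.inl (by linarith))]
    simp
  have h4 : (1 - ε ^ η) / η ≤ 1 / η := by
    have : 0 ≤ ε ^ η := by positivity
    gcongr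
    linarith
  calc _ ≤ 3 ^ (-η) * Real.log (1 / ε) - (1 - ε ^ η) / η := by linarith
    _ = ε⁻¹ * (ε * (3 ^ (-η) * Real.log (1 / ε) - (1 - ε ^ η) / η)) := by
        rw [inv_mul_cancel_left₀ hε.ne']
    _ ≤ _ := mul_le_mul_of_nonneg_left (h3 ▸ h2.trans h1) (by positivity)

end Growth

/-! ### Product functions on `ℝ^{n+1}` -/

section Product

variable {n : ℕ}

/-- The projection of `ℝ^{n+1}` to its first coordinate. -/
noncomputable def headProj (n : ℕ) : EuclideanSpace ℝ (Fin (n + 1)) →L[ℝ] ℝ :=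
  EuclideanSpace.proj 0

/-- The projection of `ℝ^{n+1}` to its last `n` coordinates. -/
noncomputable def tailProj (n : ℕ) :
    EuclideanSpace ℝ (Fin (n + 1)) →L[ℝ] EuclideanSpace ℝ (Fin n) :=
  (EuclideanSpace.equiv (Fin n) ℝ).symm.toContinuousLinearMap ∘L
    ContinuousLinearMap.pi fun i => EuclideanSpace.proj i.succ

theorem tailProj_apply (x : EuclideanSpace ℝ (Fin (n + 1))) (i : Fin n) :
    tailProj n x i = x i.succ := rfl

theorem norm_sq_eq_head_add_tail (x : EuclideanSpace ℝ (Fin (n + 1))) :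
    ‖x‖ ^ 2 = x 0 ^ 2 + ‖tailProj n x‖ ^ 2 := by
  simp [EuclideanSpace.real_norm_sq_eq, Fin.sum_univ_succ, tailProj_apply]

/-- The splitting `ℝ^{n+1} ≃ ℝ × ℝ^n` into the first and the remaining coordinates. -/
noncomputable def splitEquiv (n : ℕ) :
    EuclideanSpace ℝ (Fin (n + 1)) ≃ᵐ ℝ × EuclideanSpace ℝ (Fin n) :=
  (MeasurableEquiv.toLp 2 (Fin (n + 1) → ℝ)).symm.trans
    ((MeasurableEquiv.piFinSuccAbove (fun _ => ℝ) 0).trans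
      ((MeasurableEquiv.refl ℝ).prodCongr (MeasurableEquiv.toLp 2 (Fin n → ℝ))))

theorem measurePreserving_splitEquiv (n : ℕ) : MeasurePreserving (splitEquiv n) :=
  ((MeasurePreserving.id volume).prod (PiLp.volume_preserving_toLp (Fin n))).comp
    ((volume_preserving_piFinSuccAbove (fun _ : Fin (n + 1) => ℝ) 0).comp
      (PiLp.volume_preserving_ofLp (Fin (n + 1))))

theorem integral_head_mul_tail (f : ℝ → ℝ) (g : EuclideanSpace ℝ (Fin n) → ℝ) :
    ∫ x : EuclideanSpace ℝ (Fin (n + 1)), f (x 0) * g (tailProj n x) = (∫ a, f a) * ∫ b, g b := by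
  rw [← integral_prod_mul f g]
  exact (measurePreserving_splitEquiv n).integral_comp' fun p => f p.1 * g p.2

theorem lintegral_head_mul_tail {f : ℝ → ℝ≥0∞} {g : EuclideanSpace ℝ (Fin n) → ℝ≥0∞}
    (hf : Measurable f) (hg : Measurable g) :
    ∫⁻ x : EuclideanSpace ℝ (Fin (n + 1)), f (x 0) * g (tailProj n x) =
      (∫⁻ a, f a) * ∫⁻ b, g b := by
  rw [← lintegral_prod_mul hf.aemeasurable hg.aemeasurable]
  exact (measurePreserving_splitEquiv n).lintegral_comp_emb (splitEquiv n).measurableEmbedding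
    fun p => f p.1 * g p.2

theorem integrable_head_mul_tail {f : ℝ → ℝ} {g : EuclideanSpace ℝ (Fin n) → ℝ}
    (hf : Integrable f) (hg : Integrable g) :
    Integrable fun x : EuclideanSpace ℝ (Fin (n + 1)) => f (x 0) * g (tailProj n x) :=
  ((measurePreserving_splitEquiv n).integrable_comp_emb
    (splitEquiv n).measurableEmbedding).2 (hf.mul_prod hg)

theorem heatKernel_eq_head_mul_tail {t : ℝ} (ht : 0 < t) (x : EuclideanSpace ℝ (Fin (n + 1))) :
    heatKernel t x = heatKernel t (x 0) * heatKernel t (tailProj n x) := by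
  have h : (4 * Real.pi * t) ^ (-(((n + 1 : ℕ) : ℝ) / 2)) =
      (4 * Real.pi * t) ^ (-((1 : ℕ) : ℝ) / 2) * (4 * Real.pi * t) ^ (-((n : ℝ) / 2)) := by
    rw [← Real.rpow_add (by positivity)]
    congr 1
    push_cast
    ring
  have he : -((x 0 ^ 2 + ‖tailProj n x‖ ^ 2) / (4 * t)) =
      -(x 0 ^ 2 / (4 * t)) + -(‖tailProj n x‖ ^ 2 / (4 * t)) := by ring
  unfold heatKernel
  rw [finrank_euclideanSpace_fin, finrank_euclideanSpace_fin, Module.finrank_self, h,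
    norm_sq_eq_head_add_tail, he, Real.exp_add, Real.norm_eq_abs, sq_abs, neg_div]
  ring

/-- The product function `x ↦ V(x₀) K(x₁, …, x_n)`. -/
noncomputable def productFun (V : ℝ → ℝ) (K : EuclideanSpace ℝ (Fin n) → ℝ)
    (x : EuclideanSpace ℝ (Fin (n + 1))) : ℝ := V (x 0) * K (tailProj n x)

variable {V : ℝ → ℝ} {K : EuclideanSpace ℝ (Fin n) → ℝ}

theorem isTame_productFun (hV : IsTame V) (hK : IsTame K) : IsTame (productFun V K) where
  continuous := by
    have h1 := hV.continuous
    have h2 := hK.continuous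
    unfold productFun
    fun_prop
  integrable := integrable_head_mul_tail hV.integrable hK.integrable
  bounded := by
    obtain ⟨M, hM⟩ := hV.bounded
    obtain ⟨N, hN⟩ := hK.bounded
    refine ⟨M * N, fun x => ?_⟩
    rw [productFun, abs_mul]
    exact mul_le_mul (hM _) (hN _) (abs_nonneg _) ((abs_nonneg _).trans (hM 0))

theorem heatFlow_productFun {t : ℝ} (ht : 0 < t) (V : ℝ → ℝ) (K : EuclideanSpace ℝ (Fin n) → ℝ)
    (x : EuclideanSpace ℝ (Fin (n + 1))) :
    heatFlow t (productFun V K) x = heatFlow t V (x 0) * heatFlow t K (tailProj n x) := by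
  unfold heatFlow
  rw [← integral_head_mul_tail]
  refine integral_congr_ae (Filter.Eventually.of_forall fun y => ?_)
  simp only [heatKernel_eq_head_mul_tail ht, productFun, map_sub, PiLp.sub_apply]
  ring

theorem integral_heatFlow {t : ℝ} (ht : 0 < t) (hK : Integrable K) :
    ∫ x, heatFlow t K x = ∫ y, K y := by
  have h := integral_integral_swap (f := fun x y => heatKernel t (x - y) * K y)
    ((Integrable.convolution_integrand (ContinuousLinearMap.mul ℝ ℝ) hK
      (integrable_heatKernel (E := EuclideanSpace ℝ (Fin n)) ht)).congr
      (Filter.Eventually.of_forall fun p => by simp [Function.uncurry, mul_comm]))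
  unfold heatFlow
  rw [h]
  refine integral_congr_ae (Filter.Eventually.of_forall fun y => ?_)
  dsimp only
  rw [integral_mul_const, integral_sub_right_eq_self (fun x => heatKernel t x),
    integral_heatKernel ht, one_mul]

theorem integral_head_mul_heatFlow {t : ℝ} (ht : 0 < t) (g : ℝ → ℝ) (hK : Integrable K)
    (hK1 : ∫ y, K y = 1) :
    ∫ x : EuclideanSpace ℝ (Fin (n + 1)), g (x 0) * heatFlow t (productFun V K) x =
      ∫ a, g a * heatFlow t V a := by
  simp only [heatFlow_productFun ht, ← mul_assoc]
  rw [integral_head_mul_tail (fun a => g a * heatFlow t V a), integral_heatFlow ht hK, hK1, mul_one]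

theorem contDiff_productFun (hV : ContDiff ℝ 1 V) (hK : ContDiff ℝ 1 K) :
    ContDiff ℝ 1 (productFun V K) :=
  (hV.comp (headProj n).contDiff).mul
    (hK.comp (tailProj n).contDiff)

theorem norm_gradient_productFun_le (hV : ContDiff ℝ 1 V) (hK : ContDiff ℝ 1 K)
    (x : EuclideanSpace ℝ (Fin (n + 1))) :
    ‖gradient (productFun V K) x‖ ≤
      ‖headProj n‖ *
        (‖deriv V (x 0)‖ * ‖K (tailProj n x)‖) +
      ‖tailProj n‖ * (‖V (x 0)‖ * ‖fderiv ℝ K (tailProj n x)‖) := by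
  rw [norm_gradient]
  have h1 : HasFDerivAt (fun x : EuclideanSpace ℝ (Fin (n + 1)) => V (x 0))
      (deriv V (x 0) • headProj n) x :=
    ((hV.differentiable one_ne_zero) (x 0)).hasDerivAt.comp_hasFDerivAt x
      (headProj n).hasFDerivAt
  have h2 : HasFDerivAt (fun x : EuclideanSpace ℝ (Fin (n + 1)) => K (tailProj n x))
      (fderiv ℝ K (tailProj n x) ∘L tailProj n) x :=
    ((hK.differentiable one_ne_zero) (tailProj n x)).hasFDerivAt.comp x (tailProj n).hasFDerivAt
  have h3 : fderiv ℝ (productFun V K) x = _ := (h1.mul h2).fderiv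
  rw [h3]
  refine (norm_add_le _ _).trans ((add_comm _ _).trans_le (add_le_add ?_ ?_))
  · rw [norm_smul, norm_smul]
    exact le_of_eq (by ring)
  · rw [norm_smul]
    calc _ ≤ ‖V (x 0)‖ * (‖fderiv ℝ K (tailProj n x)‖ * ‖tailProj n‖) := by
          gcongr
          exact ContinuousLinearMap.opNorm_comp_le _ _
      _ = _ := by ring

theorem lintegral_gradient_productFun_le (hV : ContDiff ℝ 1 V) (hK : ContDiff ℝ 1 K) :
    ∫⁻ x, ‖gradient (productFun V K) x‖ₑ ≤
      ‖headProj n‖ₑ *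
        ((∫⁻ a, ‖deriv V a‖ₑ) * ∫⁻ b, ‖K b‖ₑ) +
      ‖tailProj n‖ₑ * ((∫⁻ a, ‖V a‖ₑ) * ∫⁻ b, ‖fderiv ℝ K b‖ₑ) := by
  have m1 : Measurable (deriv V) := measurable_deriv V
  have m2 := hK.continuous.measurable
  have m3 := hV.continuous.measurable
  have m4 : Measurable (fderiv ℝ K) := (hK.continuous_fderiv one_ne_zero).measurable
  rw [← lintegral_head_mul_tail m1.enorm m2.enorm, ← lintegral_head_mul_tail m3.enorm m4.enorm,
    ← lintegral_const_mul' _ _ enorm_ne_top, ← lintegral_const_mul' _ _ enorm_ne_top,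
    ← lintegral_add_left (by fun_prop)]
  refine lintegral_mono fun x => ?_
  have h := norm_gradient_productFun_le hV hK x
  simp only [← ofReal_norm]
  rw [← ENNReal.ofReal_mul (norm_nonneg _), ← ENNReal.ofReal_mul (norm_nonneg _),
    ← ENNReal.ofReal_mul (norm_nonneg _), ← ENNReal.ofReal_mul (norm_nonneg _),
    ← ENNReal.ofReal_add (by positivity) (by positivity)]
  exact ENNReal.ofReal_le_ofReal h

end Product

/-! ### A measure of dimension `d - α` near a hyperplane, and the Hausdorff content -/

section Frostman

variable {n : ℕ} {α : ℝ}

/-- The function `a^{-α}` on `(0, r]`, extended by zero. -/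
noncomputable def truncatedPower (α r : ℝ) : ℝ → ℝ≥0∞ :=
  (Ioc 0 r).indicator fun a => ENNReal.ofReal (a ^ (-α))

theorem measurable_truncatedPower (α r : ℝ) : Measurable (truncatedPower α r) :=
  Measurable.indicator (by fun_prop) measurableSet_Ioc

/-- At `a = 0` the left-hand side vanishes, by the convention `0 ^ (-α) = 0`. -/
theorem ofReal_abs_rpow_le (hα0 : 0 < α) {r : ℝ} (hr : 0 < r) (a : ℝ) :
    ENNReal.ofReal (|a| ^ (-α)) ≤
      truncatedPower α r a + truncatedPower α r (-a) + ENNReal.ofReal (r ^ (-α)) := by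
  rcases eq_or_ne a 0 with rfl | ha
  · simp [Real.zero_rpow (neg_ne_zero.2 hα0.ne')]
  rcases le_total r |a| with h | h
  · refine le_add_left (ENNReal.ofReal_le_ofReal ?_)
    exact Real.rpow_le_rpow_of_nonpos hr h (by linarith)
  · refine le_add_right ?_
    rcases lt_or_gt_of_ne ha with h0 | h0
    · refine le_add_left ?_
      rw [abs_of_neg h0] at h ⊢
      rw [truncatedPower, indicator_of_mem (show -a ∈ Ioc 0 r from ⟨by linarith, h⟩)]
    · refine le_add_right ?_
      rw [abs_of_pos h0] at h ⊢
      rw [truncatedPower, indicator_of_mem (show a ∈ Ioc 0 r from ⟨h0, h⟩)]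

theorem lintegral_truncatedPower (hα1 : α < 1) {r : ℝ} (hr : 0 < r) :
    ∫⁻ a, truncatedPower α r a = ENNReal.ofReal (r ^ (1 - α) / (1 - α)) := by
  unfold truncatedPower
  rw [lintegral_indicator measurableSet_Ioc, ← ofReal_integral_eq_lintegral_ofReal
    ((intervalIntegrable_iff_integrableOn_Ioc_of_le hr.le).1
      (intervalIntegral.intervalIntegrable_rpow' (by linarith)))
    ((ae_restrict_mem measurableSet_Ioc).mono fun a ha => Real.rpow_nonneg ha.1.le _),
    ← intervalIntegral.integral_of_le hr.le, integral_rpow (Or.inl (by linarith)),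
    Real.zero_rpow (by linarith), sub_zero, show -α + 1 = 1 - α by ring]

theorem setLIntegral_abs_rpow_le (hα0 : 0 < α) (hα1 : α < 1) {r : ℝ} (hr : 0 < r) (x : ℝ) :
    ∫⁻ a in Metric.ball x r, ENNReal.ofReal (|a| ^ (-α)) ≤
      ENNReal.ofReal ((2 / (1 - α) + 2) * r ^ (1 - α)) := by
  have hm := measurable_truncatedPower α r
  have h1 : (0 : ℝ) < 1 - α := by linarith
  calc _ ≤ ∫⁻ a in Metric.ball x r, (truncatedPower α r a + truncatedPower α r (-a) +
        ENNReal.ofReal (r ^ (-α))) := lintegral_mono fun a => ofReal_abs_rpow_le hα0 hr a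
    _ = (∫⁻ a in Metric.ball x r, (truncatedPower α r a + truncatedPower α r (-a))) +
        ENNReal.ofReal (r ^ (-α)) * ENNReal.ofReal (2 * r) := by
        rw [lintegral_add_right _ measurable_const, setLIntegral_const, Real.volume_ball]
    _ ≤ (∫⁻ a, (truncatedPower α r a + truncatedPower α r (-a))) +
        ENNReal.ofReal (r ^ (-α)) * ENNReal.ofReal (2 * r) := by
        gcongr
        exact Measure.restrict_le_self
    _ = _ := by
        rw [lintegral_add_left hm, lintegral_neg_eq_self (truncatedPower α r),
          lintegral_truncatedPower hα1 hr, ← ENNReal.ofReal_add (by positivity) (by positivity),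
          ← ENNReal.ofReal_mul (by positivity), ← ENNReal.ofReal_add (by positivity) (by positivity)]
        congr 1
        have : r ^ (1 - α) = r ^ (-α) * r := by
          rw [← Real.rpow_add_one hr.ne']; congr 1; ring
        rw [this]
        field_simp
        ring

/-- The measure `c |x₀|^{-α} dx`, concentrated near the hyperplane `x₀ = 0`. -/
noncomputable def hyperplaneMeasure (n : ℕ) (α c : ℝ) :
    Measure (EuclideanSpace ℝ (Fin (n + 1))) :=
  volume.withDensity fun x => ENNReal.ofReal (c * |x 0| ^ (-α))

variable (n α) in
/-- The constant in the growth bound for `hyperplaneMeasure n α 1`. -/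
noncomputable def hyperplaneConst : ℝ :=
  (2 / (1 - α) + 2) * (volume (Metric.ball (0 : EuclideanSpace ℝ (Fin n)) 1)).toReal

theorem hyperplaneConst_pos (hα1 : α < 1) : 0 < hyperplaneConst n α := by
  have h1 : (0 : ℝ) < 1 - α := by linarith
  refine mul_pos (by positivity) (ENNReal.toReal_pos ?_ measure_ball_lt_top.ne)
  exact (Metric.measure_ball_pos volume _ one_pos).ne'

theorem hyperplaneMeasure_ball_le (hα0 : 0 < α) (hα1 : α < 1) {c : ℝ} (hc : 0 < c)
    (x : EuclideanSpace ℝ (Fin (n + 1))) {r : ℝ} (hr : 0 < r) :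
    hyperplaneMeasure n α c (Metric.ball x r) ≤
      ENNReal.ofReal (c * hyperplaneConst n α * r ^ (((n + 1 : ℕ) : ℝ) - α)) := by
  have h1 : (0 : ℝ) < 1 - α := by linarith
  set f : ℝ → ℝ≥0∞ := (Metric.ball (x 0) r).indicator fun a => ENNReal.ofReal (|a| ^ (-α)) with hf
  set g : EuclideanSpace ℝ (Fin n) → ℝ≥0∞ := (Metric.ball (tailProj n x) r).indicator 1 with hg
  have hfm : Measurable f := Measurable.indicator (by fun_prop) measurableSet_ball
  have hgm : Measurable g := measurable_one.indicator measurableSet_ball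
  have hsub : ∀ y ∈ Metric.ball x r, y 0 ∈ Metric.ball (x 0) r ∧
      tailProj n y ∈ Metric.ball (tailProj n x) r := by
    intro y hy
    rw [Metric.mem_ball, dist_eq_norm] at hy
    have h := norm_sq_eq_head_add_tail (y - x)
    have h0 : ‖y - x‖ ^ 2 < r ^ 2 := by gcongr
    rw [Metric.mem_ball, Metric.mem_ball, dist_eq_norm, dist_eq_norm, ← map_sub, Real.norm_eq_abs]
    refine ⟨abs_lt_of_sq_lt_sq ?_ hr.le, lt_of_pow_lt_pow_left₀ 2 hr.le ?_⟩
    · have : (y - x) 0 = y 0 - x 0 := rfl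
      rw [← this]
      nlinarith [sq_nonneg ‖tailProj n (y - x)‖]
    · nlinarith [sq_nonneg ((y - x) 0)]
  rw [hyperplaneMeasure, withDensity_apply _ measurableSet_ball, ← lintegral_indicator
    measurableSet_ball]
  calc _ ≤ ∫⁻ y : EuclideanSpace ℝ (Fin (n + 1)),
        ENNReal.ofReal c * (f (y 0) * g (tailProj n y)) := by
        refine lintegral_mono fun y => ?_
        by_cases hy : y ∈ Metric.ball x r
        · obtain ⟨h0, h'⟩ := hsub y hy
          rw [indicator_of_mem hy, hf, hg, indicator_of_mem h0, indicator_of_mem h',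
            ENNReal.ofReal_mul hc.le]
          simp
        · rw [indicator_of_notMem hy]
          exact zero_le
    _ = ENNReal.ofReal c * ((∫⁻ a in Metric.ball (x 0) r, ENNReal.ofReal (|a| ^ (-α))) *
        volume (Metric.ball (tailProj n x) r)) := by
        rw [lintegral_const_mul' _ _ ENNReal.ofReal_ne_top, lintegral_head_mul_tail hfm hgm, hf, hg,
          lintegral_indicator measurableSet_ball, lintegral_indicator_one measurableSet_ball]
    _ ≤ ENNReal.ofReal c * (ENNReal.ofReal ((2 / (1 - α) + 2) * r ^ (1 - α)) *
        (ENNReal.ofReal (r ^ n) *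
          ENNReal.ofReal (volume (Metric.ball (0 : EuclideanSpace ℝ (Fin n)) 1)).toReal)) := by
        rw [ENNReal.ofReal_toReal measure_ball_lt_top.ne, Measure.addHaar_ball_of_pos _ _ hr,
          finrank_euclideanSpace_fin]
        gcongr
        exact setLIntegral_abs_rpow_le hα0 hα1 hr _
    _ = _ := by
        rw [← ENNReal.ofReal_mul (by positivity), ← ENNReal.ofReal_mul (by positivity),
          ← ENNReal.ofReal_mul hc.le]
        congr 1
        have : r ^ (((n + 1 : ℕ) : ℝ) - α) = r ^ (1 - α) * r ^ n := by
          rw [← Real.rpow_natCast, ← Real.rpow_add hr]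
          congr 1
          push_cast
          ring
        rw [this, hyperplaneConst]
        ring

theorem regular_hyperplaneMeasure (hα0 : 0 < α) (hα1 : α < 1) {c : ℝ} (hc : 0 < c) :
    (hyperplaneMeasure n α c).Regular := by
  have : IsLocallyFiniteMeasure (hyperplaneMeasure n α c) := by
    refine ⟨fun x => ⟨Metric.ball x 1, Metric.ball_mem_nhds x one_pos, ?_⟩⟩
    exact (hyperplaneMeasure_ball_le hα0 hα1 hc x one_pos).trans_lt ENNReal.ofReal_lt_top
  infer_instance

theorem lintegral_hyperplaneMeasure {c : ℝ} (hc : 0 < c)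
    {u : EuclideanSpace ℝ (Fin (n + 1)) → ℝ} (hu : Continuous u) :
    ∫⁻ x, ‖u x‖ₑ ∂hyperplaneMeasure n α c =
      ENNReal.ofReal c * ∫⁻ x, ENNReal.ofReal (|x 0| ^ (-α)) * ‖u x‖ₑ := by
  rw [hyperplaneMeasure, lintegral_withDensity_eq_lintegral_mul _ (by fun_prop) (by fun_prop),
    ← lintegral_const_mul' _ _ ENNReal.ofReal_ne_top]
  refine lintegral_congr fun x => ?_
  rw [Pi.mul_apply, ENNReal.ofReal_mul hc.le, mul_assoc]

/-- The weight `|x₀|^{-α}` has bounded integrals against all translates of a product function. -/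
theorem exists_lintegral_oddPower_mul_le (hα0 : 0 < α) (hα1 : α < 1) {V : ℝ → ℝ}
    {K : EuclideanSpace ℝ (Fin n) → ℝ} (hV : IsTame V) (hK : IsTame K) :
    ∃ S : ℝ≥0∞, S ≠ ⊤ ∧ ∀ z : EuclideanSpace ℝ (Fin (n + 1)),
      ∫⁻ y, ‖oddPower α (y 0)‖ₑ * ‖productFun V K (y - z)‖ₑ ≤ S := by
  obtain ⟨M, hM⟩ := hV.bounded
  have hVm := hV.continuous.measurable
  have hKm := hK.continuous.measurable
  have hm := measurable_truncatedPower α 1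
  have hom := measurable_oddPower α
  set T : ℝ≥0∞ := ENNReal.ofReal ((1 : ℝ) ^ (1 - α) / (1 - α)) with hT
  refine ⟨((T + T) * ENNReal.ofReal M + ∫⁻ a, ‖V a‖ₑ) * ∫⁻ b, ‖K b‖ₑ, ?_, fun z => ?_⟩
  · refine ENNReal.mul_ne_top (ENNReal.add_ne_top.2 ⟨?_, hV.integrable.2.ne⟩) hK.integrable.2.ne
    exact ENNReal.mul_ne_top (ENNReal.add_ne_top.2 ⟨ENNReal.ofReal_ne_top, ENNReal.ofReal_ne_top⟩)
      ENNReal.ofReal_ne_top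
  have h1 : ∫⁻ y : EuclideanSpace ℝ (Fin (n + 1)),
      ‖oddPower α (y 0)‖ₑ * ‖productFun V K (y - z)‖ₑ =
      (∫⁻ a, ‖oddPower α a‖ₑ * ‖V (a - z 0)‖ₑ) * ∫⁻ b, ‖K (b - tailProj n z)‖ₑ := by
    rw [← lintegral_head_mul_tail (f := fun a => ‖oddPower α a‖ₑ * ‖V (a - z 0)‖ₑ)
      (g := fun b => ‖K (b - tailProj n z)‖ₑ) (by fun_prop) (by fun_prop)]
    refine lintegral_congr fun y => ?_
    rw [productFun, enorm_mul, map_sub, mul_assoc]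
    rfl
  rw [h1, lintegral_sub_right_eq_self (fun b => ‖K b‖ₑ)]
  gcongr
  calc ∫⁻ a, ‖oddPower α a‖ₑ * ‖V (a - z 0)‖ₑ
      ≤ ∫⁻ a, ((truncatedPower α 1 a + truncatedPower α 1 (-a)) * ENNReal.ofReal M +
          ‖V (a - z 0)‖ₑ) := by
        refine lintegral_mono fun a => ?_
        have h2 : ‖oddPower α a‖ₑ ≤ truncatedPower α 1 a + truncatedPower α 1 (-a) + 1 := by
          rw [Real.enorm_eq_ofReal_abs]
          refine (ENNReal.ofReal_le_ofReal (abs_oddPower_le α a)).trans ?_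
          simpa using ofReal_abs_rpow_le hα0 one_pos a
        calc _ ≤ (truncatedPower α 1 a + truncatedPower α 1 (-a) + 1) * ‖V (a - z 0)‖ₑ := by gcongr
          _ = (truncatedPower α 1 a + truncatedPower α 1 (-a)) * ‖V (a - z 0)‖ₑ +
              ‖V (a - z 0)‖ₑ := by rw [add_mul, one_mul]
          _ ≤ _ := by
              gcongr
              rw [Real.enorm_eq_ofReal_abs]
              exact ENNReal.ofReal_le_ofReal (hM _)
    _ = _ := by
        rw [lintegral_add_right _ (by fun_prop), lintegral_mul_const' _ _ ENNReal.ofReal_ne_top,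
          lintegral_add_left hm, lintegral_neg_eq_self (truncatedPower α 1),
          lintegral_truncatedPower hα1 one_pos, lintegral_sub_right_eq_self (fun a => ‖V a‖ₑ)]

end Frostman

section HausdorffContent

variable {d : ℕ} {s C : ℝ} {μ : Measure (EuclideanSpace ℝ (Fin d))}

theorem mul_measure_le_compactHausdorffContent (hs : 0 < s) (hC : 0 < C)
    (hμ : ∀ (x : EuclideanSpace ℝ (Fin d)) (r : ℝ), 0 < r →
      μ (Metric.ball x r) ≤ ENNReal.ofReal (C * r ^ s)) (K : Set (EuclideanSpace ℝ (Fin d))) :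
    ENNReal.ofReal (Real.pi ^ (s / 2) / Real.Gamma (s / 2 + 1) / C) * μ K ≤
      compactHausdorffContent s K := by
  have hω : 0 ≤ Real.pi ^ (s / 2) / Real.Gamma (s / 2 + 1) := by
    have := Real.Gamma_pos_of_pos (by linarith : 0 < s / 2 + 1)
    positivity
  refine le_iInf fun x => le_iInf fun r => le_iInf fun hK => ?_
  calc _ ≤ ENNReal.ofReal (Real.pi ^ (s / 2) / Real.Gamma (s / 2 + 1) / C) *
        ∑' i, ENNReal.ofReal (C * (r i : ℝ) ^ s) := by
        gcongr
        refine (measure_mono hK).trans ((measure_iUnion_le _).trans (ENNReal.tsum_le_tsum fun i => ?_))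
        -- the growth bound is only assumed for positive radii; a ball of radius `0` is empty
        rcases (r i).2.eq_or_lt with h | h
        · have h' : (r i : ℝ) = 0 := h.symm
          simp [h']
        · exact hμ _ _ h
    _ = _ := by
        rw [← ENNReal.tsum_mul_left]
        refine tsum_congr fun i => ?_
        rw [← ENNReal.ofReal_mul (by positivity)]
        congr 1
        field_simp

/-- A measure with the growth of an `s`-dimensional measure is dominated by the Hausdorff content
of dimension `s`. -/
theorem mul_measure_le_hausdorffContent (hs : 0 < s) (hC : 0 < C) [μ.Regular]
    (hμ : ∀ (x : EuclideanSpace ℝ (Fin d)) (r : ℝ), 0 < r →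
      μ (Metric.ball x r) ≤ ENNReal.ofReal (C * r ^ s)) (A : Set (EuclideanSpace ℝ (Fin d))) :
    ENNReal.ofReal (Real.pi ^ (s / 2) / Real.Gamma (s / 2 + 1) / C) * μ A ≤
      hausdorffContent s A := by
  refine le_iInf fun U => le_iInf fun hU => le_iInf fun hAU => ?_
  refine (mul_le_mul_right (measure_mono hAU) _).trans ?_
  rw [hU.measure_eq_iSup_isCompact]
  simp only [ENNReal.mul_iSup]
  exact iSup_le fun K => iSup_le fun hKU => iSup_le fun hK =>
    (mul_measure_le_compactHausdorffContent hs hC hμ K).trans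
      (le_iSup_of_le K (le_iSup_of_le hK (le_iSup_of_le hKU le_rfl)))

end HausdorffContent

/-! ### The counterexample -/

section Counterexample

theorem IsTame.memLp {E : Type*} [NormedAddCommGroup E] [InnerProductSpace ℝ E]
    [FiniteDimensional ℝ E] [MeasurableSpace E] [BorelSpace E] {u : E → ℝ} (hu : IsTame u) {q : ℝ}
    (hq : 1 ≤ q) : MemLp u (ENNReal.ofReal q) := by
  obtain ⟨M, hM⟩ := hu.bounded
  have hq0 : 0 < q := by linarith
  have hc := hu.continuous
  rw [← integrable_norm_rpow_iff hu.integrable.1 (by simpa using hq0) ENNReal.ofReal_ne_top,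
    ENNReal.toReal_ofReal hq0.le]
  refine (hu.integrable.norm.const_mul (M ^ (q - 1))).mono'
    (by fun_prop : Measurable fun x => ‖u x‖ ^ q).aestronglyMeasurable
    (Filter.Eventually.of_forall fun x => ?_)
  rw [Real.norm_of_nonneg (by positivity)]
  have h1 : ‖u x‖ ^ q = ‖u x‖ ^ (q - 1) * ‖u x‖ := by
    rcases (norm_nonneg (u x)).eq_or_lt with h | h
    · rw [← h, Real.zero_rpow hq0.ne', mul_zero]
    · rw [← Real.rpow_add_one h.ne']; congr 1; ring
  rw [h1]
  exact mul_le_mul_of_nonneg_right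
    (Real.rpow_le_rpow (norm_nonneg _) (hM x) (by linarith)) (norm_nonneg _)

variable {n : ℕ} {α ε : ℝ}

/-- The constant relating the Riesz potential of `smoothedFracLaplacian ((1 - α) / 2) ε v` to the
time average of the heat flow of `v`. Its value plays no role, only that it does not depend
on `ε`. -/
noncomputable def potentialConst (n : ℕ) (α : ℝ) : ℝ :=
  1 / rieszGamma (n + 1) (1 - α) *
    ((heatRieszConst (EuclideanSpace ℝ (Fin (n + 1))) (1 - α))⁻¹ * betaConst ((1 - α) / 2))

theorem rieszPotential_eq_meanHeatKernel (hα0 : 0 < α) (hα1 : α < 1) (hε : 0 < ε)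
    {v : EuclideanSpace ℝ (Fin (n + 1)) → ℝ} (hv : IsTame v)
    (x : EuclideanSpace ℝ (Fin (n + 1))) :
    rieszPotential (1 - α) (smoothedFracLaplacian ((1 - α) / 2) ε v) x =
      potentialConst n α * ∫ z, meanHeatKernel ε z * v (x - z) := by
  have h := rieszPotential_smoothedFracLaplacian (s := 1 - α) (by linarith) (by linarith) hε hv x
  rw [finrank_euclideanSpace_fin] at h
  rw [rieszPotential, h, integral_heatFlow_eq_meanHeatKernel hε hv, potentialConst]
  ring

theorem isFractionalGradient_smoothedFracLaplacian (hα0 : 0 < α) (hα1 : α < 1) (hε : 0 < ε)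
    {v : EuclideanSpace ℝ (Fin (n + 1)) → ℝ} (hv : IsTame v) (hv1 : ContDiff ℝ 1 v)
    (hg : Integrable (gradient v)) :
    IsFractionalGradient α (smoothedFracLaplacian ((1 - α) / 2) ε v)
      fun x => potentialConst n α • convGradient (meanHeatKernel ε) v x := by
  have hk := integrable_meanHeatKernel (E := EuclideanSpace ℝ (Fin (n + 1))) ε
  refine ⟨((integrable_convGradient hk hg).fun_smul (potentialConst n α)).locallyIntegrable, fun Φ hΦ hΦc => ?_⟩
  simp only [real_inner_smul_left, rieszPotential_eq_meanHeatKernel hα0 hα1 hε hv, mul_assoc]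
  rw [integral_const_mul, integral_const_mul, integral_inner_convGradient hk hv1 hv hg hΦ hΦc,
    mul_neg]

/-- The pairing of the counterexample with `sgn(x₀) |x₀|^{-α}` grows like `log (1 / ε)`. -/
theorem log_le_integral_oddPower_mul (hα0 : 0 < α) (hα1 : α < 1) (hε : 0 < ε) (hε1 : ε ≤ 1)
    {K : EuclideanSpace ℝ (Fin n) → ℝ} (hK : IsTame K) (hK1 : ∫ y, K y = 1) :
    heatMoment (1 - α) / 2 * (3 ^ (-(1 - (1 - α) / 2)) * Real.log (1 / ε) -
        1 / (1 - (1 - α) / 2)) ≤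
      ∫ x : EuclideanSpace ℝ (Fin (n + 1)), oddPower α (x 0) *
        smoothedFracLaplacian ((1 - α) / 2) ε (productFun (jumpProfile ε) K) x := by
  have hV := isTame_jumpProfile hε hε1
  have hv := isTame_productFun hV hK
  obtain ⟨S, hS', hS⟩ := exists_lintegral_oddPower_mul_le hα0 hα1 hV hK
  have hW : Measurable fun x : EuclideanSpace ℝ (Fin (n + 1)) => oddPower α (x 0) :=
    (measurable_oddPower α).comp (by fun_prop)
  have hA : 0 < heatMoment (1 - α) / 2 := half_pos (heatMoment_pos (by linarith))
  set η : ℝ := 1 - (1 - α) / 2 with hη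
  have hη0 : 0 < η := by rw [hη]; linarith
  have hβ : (1 - α) / 2 = 1 - η := by rw [hη]; ring
  have hpair : ∀ t > 0, Integrable (fun x : EuclideanSpace ℝ (Fin (n + 1)) =>
      oddPower α (x 0) * heatFlow t (productFun (jumpProfile ε) K) x) := by
    intro t ht
    simp only [heatFlow_productFun ht, ← mul_assoc]
    refine integrable_head_mul_tail (f := fun a => oddPower α a * heatFlow t (jumpProfile ε) a) ?_
      (integrable_heatFlow ht hK.integrable)
    obtain ⟨S, hS', hS⟩ := exists_lintegral_oddPower_mul_le (n := n) hα0 hα1 (hV.heatFlow ht) hK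
    have hm : Measurable fun a => oddPower α a * heatFlow t (jumpProfile ε) a :=
      (measurable_oddPower α).mul (hV.heatFlow ht).continuous.measurable
    refine ⟨hm.aestronglyMeasurable, ?_⟩
    have h0 := hS 0
    simp only [sub_zero, productFun, enorm_mul, ← mul_assoc] at h0
    simp only [← enorm_mul (oddPower α _)] at h0
    rw [lintegral_head_mul_tail (f := fun a => ‖oddPower α a * heatFlow t (jumpProfile ε) a‖ₑ)
      hm.enorm hK.continuous.measurable.enorm] at h0
    refine lt_of_le_of_lt ?_ (h0.trans_lt hS'.lt_top)
    refine le_mul_of_one_le_right' ?_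
    calc (1 : ℝ≥0∞) = ‖∫ y, K y‖ₑ := by rw [hK1, enorm_one]
      _ ≤ _ := enorm_integral_le_lintegral_enorm _
  have hD : ∀ t ∈ Ioi (0 : ℝ), ∫ x : EuclideanSpace ℝ (Fin (n + 1)), oddPower α (x 0) *
      heatDiff ε (productFun (jumpProfile ε) K) t x = heatMoment (1 - α) / 2 *
        ((∫ τ in ε..1, (t + τ) ^ (-η)) - ∫ τ in ε..1, (t + ε + τ) ^ (-η)) := by
    intro t ht
    have ht0 : 0 < t := ht
    have ht1 : 0 < t + ε := by positivity
    simp only [heatDiff, mul_sub]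
    rw [integral_sub (hpair t ht0) (hpair _ ht1),
      integral_head_mul_heatFlow ht0 _ hK.integrable hK1,
      integral_head_mul_heatFlow ht1 _ hK.integrable hK1,
      integral_oddPower_mul_heatFlow hα1 hε hε1 ht0, integral_oddPower_mul_heatFlow hα1 hε hε1 ht1]
  have hcongr : ∀ t ∈ Ioi (0 : ℝ), t ^ (-((1 - α) / 2)) *
      ∫ x : EuclideanSpace ℝ (Fin (n + 1)), oddPower α (x 0) *
        heatDiff ε (productFun (jumpProfile ε) K) t x = heatMoment (1 - α) / 2 *
      (t ^ (-(1 - η)) * ((∫ τ in ε..1, (t + τ) ^ (-η)) - ∫ τ in ε..1, (t + ε + τ) ^ (-η))) := by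
    intro t ht
    rw [hD t ht, hβ]
    ring
  have hint : IntegrableOn (fun t => t ^ (-(1 - η)) * ((∫ τ in ε..1, (t + τ) ^ (-η)) -
      ∫ τ in ε..1, (t + ε + τ) ^ (-η))) (Ioi 0) := by
    have h := (integrable_weight_mul_heatDiff (β := (1 - α) / 2) (by linarith) (by linarith) hε hv
      hW hS' hS).integral_prod_left.const_mul (heatMoment (1 - α) / 2)⁻¹
    refine IntegrableOn.congr_fun h (fun t ht => ?_) measurableSet_Ioi
    have e := hcongr t ht
    rw [← integral_const_mul] at e
    simp only [mul_left_comm (oddPower α _)]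
    rw [e, inv_mul_cancel_left₀ hA.ne']
  rw [integral_weight_mul_smoothedFracLaplacian (by linarith) (by linarith) hε hv hW hS' hS,
    setIntegral_congr_fun measurableSet_Ioi hcongr, integral_const_mul, mul_left_comm]
  exact mul_le_mul_of_nonneg_left (log_le_integral_rpow_mul_sub hη0 hε hε1 hint) hA.le

/-- There are functions whose fractional gradients are bounded in `L¹`, while their integrals against
`|x₀|^{-α} dx` are arbitrarily large. -/
theorem exists_fractionalGradient_bounded (n : ℕ) (hα0 : 0 < α) (hα1 : α < 1) :
    ∃ B : ℝ≥0∞, B ≠ ⊤ ∧ ∀ N : ℝ≥0, ∃ (u : EuclideanSpace ℝ (Fin (n + 1)) → ℝ)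
      (G : EuclideanSpace ℝ (Fin (n + 1)) → EuclideanSpace ℝ (Fin (n + 1))),
      IsTame u ∧ IsFractionalGradient α u G ∧ Integrable G ∧ ∫⁻ x, ‖G x‖ₑ ≤ B ∧
        N ≤ ∫⁻ x, ENNReal.ofReal (|x 0| ^ (-α)) * ‖u x‖ₑ := by
  obtain ⟨f⟩ : Nonempty (ContDiffBump (0 : EuclideanSpace ℝ (Fin n))) := ⟨⟨1, 2, one_pos, by norm_num⟩⟩
  set K : EuclideanSpace ℝ (Fin n) → ℝ := f.normed volume with hKdef
  have hKc : HasCompactSupport K := f.hasCompactSupport_normed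
  have hKs : ContDiff ℝ 1 K := f.contDiff_normed
  have hK1 : ∫ y, K y = 1 := f.integral_normed
  have hK : IsTame K := ⟨hKs.continuous, hKs.continuous.integrable_of_hasCompactSupport hKc,
    hKs.continuous.bounded_above_of_compact_support hKc⟩
  have hK' : Integrable (fderiv ℝ K) :=
    (hKs.continuous_fderiv one_ne_zero).integrable_of_hasCompactSupport (hKc.fderiv ℝ)
  set B₀ : ℝ≥0∞ := ‖headProj n‖ₑ * (2 * ∫⁻ b, ‖K b‖ₑ) +
    ‖tailProj n‖ₑ * (ENNReal.ofReal (heatMoment 1) * ∫⁻ b, ‖fderiv ℝ K b‖ₑ) with hB₀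
  have hB₀' : B₀ ≠ ⊤ := ENNReal.add_ne_top.2
    ⟨ENNReal.mul_ne_top enorm_ne_top (ENNReal.mul_ne_top (by norm_num) hK.integrable.2.ne),
      ENNReal.mul_ne_top enorm_ne_top (ENNReal.mul_ne_top ENNReal.ofReal_ne_top hK'.2.ne)⟩
  refine ⟨‖potentialConst n α‖ₑ * B₀, ENNReal.mul_ne_top enorm_ne_top hB₀', fun N => ?_⟩
  -- choose `ε` so that the lower bound `A (3^{-η} log (1 / ε) - 1 / η)` equals `N`
  set A : ℝ := heatMoment (1 - α) / 2 with hA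
  have hA0 : 0 < A := half_pos (heatMoment_pos (by linarith))
  set η : ℝ := 1 - (1 - α) / 2 with hη
  have hη0 : 0 < η := by rw [hη]; linarith
  set L : ℝ := 3 ^ η * (N / A + 1 / η) with hL
  have hL0 : 0 ≤ L := by positivity
  set ε : ℝ := Real.exp (-L) with hεdef
  have hε : 0 < ε := Real.exp_pos _
  have hε1 : ε ≤ 1 := Real.exp_le_one_iff.2 (by linarith)
  set v := productFun (jumpProfile ε) K with hvdef
  have hV := isTame_jumpProfile hε hε1
  have hVs := contDiff_jumpProfile hε
  have hv : IsTame v := isTame_productFun hV hK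
  have hvs : ContDiff ℝ 1 v := contDiff_productFun hVs hKs
  have hgB : ∫⁻ x, ‖gradient v x‖ₑ ≤ B₀ := by
    refine (lintegral_gradient_productFun_le hVs hKs).trans ?_
    rw [hB₀]
    gcongr
    · exact lintegral_deriv_jumpProfile_le hε
    · exact lintegral_jumpProfile_le hε hε1
  have hg : Integrable (gradient v) :=
    ⟨(continuous_gradient hvs).aestronglyMeasurable, hgB.trans_lt hB₀'.lt_top⟩
  have hk := integrable_meanHeatKernel (E := EuclideanSpace ℝ (Fin (n + 1))) ε
  have hu : IsTame (smoothedFracLaplacian ((1 - α) / 2) ε v) :=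
    isTame_smoothedFracLaplacian (by linarith) (by linarith) hε hv
  refine ⟨smoothedFracLaplacian ((1 - α) / 2) ε v,
    fun x => potentialConst n α • convGradient (meanHeatKernel ε) v x, hu,
    isFractionalGradient_smoothedFracLaplacian hα0 hα1 hε hv hvs hg,
    (integrable_convGradient hk hg).fun_smul (potentialConst n α), ?_, ?_⟩
  · simp only [enorm_smul]
    rw [lintegral_const_mul' _ _ enorm_ne_top]
    gcongr
    refine (lintegral_convGradient_le hk hg).trans ?_
    rwa [lintegral_enorm_meanHeatKernel hε, one_mul]
  · have hlow := log_le_integral_oddPower_mul hα0 hα1 hε hε1 hK hK1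
    have hN : A * (3 ^ (-η) * Real.log (1 / ε) - 1 / η) = N := by
      rw [hεdef, one_div (Real.exp _), ← Real.exp_neg, Real.log_exp, neg_neg, hL,
        Real.rpow_neg (by norm_num), inv_mul_cancel_left₀ (by positivity)]
      field_simp
      ring
    rw [hN] at hlow
    calc (N : ℝ≥0∞) = ENNReal.ofReal N := by simp
      _ ≤ ENNReal.ofReal |∫ x : EuclideanSpace ℝ (Fin (n + 1)), oddPower α (x 0) *
          smoothedFracLaplacian ((1 - α) / 2) ε v x| :=
        ENNReal.ofReal_le_ofReal (hlow.trans (le_abs_self _))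
      _ ≤ ∫⁻ x : EuclideanSpace ℝ (Fin (n + 1)), ‖oddPower α (x 0) *
          smoothedFracLaplacian ((1 - α) / 2) ε v x‖ₑ := by
        rw [← Real.enorm_eq_ofReal_abs]
        exact enorm_integral_le_lintegral_enorm _
      _ ≤ _ := by
        refine lintegral_mono fun x => ?_
        rw [enorm_mul, Real.enorm_eq_ofReal_abs (oddPower α (x 0))]
        gcongr
        exact abs_oddPower_le α _

theorem not_exists_lintegral_hyperplaneMeasure_le (n : ℕ) (hα0 : 0 < α) (hα1 : α < 1) {c : ℝ}
    (hc : 0 < c) {T : ℝ≥0∞} (hT : T ≠ ⊤) :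
    ¬ ∀ (u : EuclideanSpace ℝ (Fin (n + 1)) → ℝ)
      (G : EuclideanSpace ℝ (Fin (n + 1)) → EuclideanSpace ℝ (Fin (n + 1))),
      IsTame u → IsFractionalGradient α u G → Integrable G →
        ∫⁻ x, ‖u x‖ₑ ∂hyperplaneMeasure n α c ≤ T * ∫⁻ x, ‖G x‖ₑ := by
  intro h
  obtain ⟨B, hB, hfam⟩ := exists_fractionalGradient_bounded n hα0 hα1
  have hc0 : ENNReal.ofReal c ≠ 0 := by simpa using hc
  have hfin : T * B / ENNReal.ofReal c ≠ ⊤ := ENNReal.div_ne_top (ENNReal.mul_ne_top hT hB) hc0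
  obtain ⟨N, hN⟩ := ENNReal.exists_nat_gt hfin
  obtain ⟨u, G, hu, hG, hGi, hGB, hlow⟩ := hfam N
  have h1 := h u G hu hG hGi
  rw [lintegral_hyperplaneMeasure hc hu.continuous] at h1
  have h2 : ENNReal.ofReal c * N ≤ T * B :=
    (mul_le_mul_right (by simpa using hlow) _).trans (h1.trans (mul_le_mul_right hGB _))
  have h3 : (N : ℝ≥0∞) ≤ T * B / ENNReal.ofReal c := by
    rw [ENNReal.le_div_iff_mul_le (Or.inl hc0) (Or.inl ENNReal.ofReal_ne_top), mul_comm]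
    exact h2
  exact absurd hN (not_lt.2 h3)

end Counterexample

/-! ### Failure of both trace inequalities -/

theorem theorem1p3 (d : ℕ) (hd : 1 ≤ d) (α : ℝ) (hα0 : 0 < α) (hα1 : α < 1)
    (q : ℝ) (hq1 : 1 ≤ q) (hq : q < (d : ℝ) / (1 - α)) :
    (∀ C' : ℝ, 0 < C' →
      ¬ ∃ C : ℝ≥0, ∀ (u : EuclideanSpace ℝ (Fin d) → ℝ)
          (G : EuclideanSpace ℝ (Fin d) → EuclideanSpace ℝ (Fin d))
          (μ : Measure (EuclideanSpace ℝ (Fin d))),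
        Continuous u → MemLp u (ENNReal.ofReal q) volume →
        IsFractionalGradient α u G → Integrable G volume →
        μ.Regular →
        (∀ (x : EuclideanSpace ℝ (Fin d)) (r : ℝ), 0 < r →
          μ (Metric.ball x r) ≤ ENNReal.ofReal (C' * r ^ ((d : ℝ) - α))) →
        ∫⁻ x, ‖u x‖ₑ ∂μ ≤ (C : ℝ≥0∞) * ∫⁻ x, ‖G x‖ₑ) ∧
    (¬ ∃ C : ℝ≥0, ∀ (u : EuclideanSpace ℝ (Fin d) → ℝ)
          (G : EuclideanSpace ℝ (Fin d) → EuclideanSpace ℝ (Fin d)),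
        Continuous u → MemLp u (ENNReal.ofReal q) volume →
        IsFractionalGradient α u G → Integrable G volume →
        ∫⁻ t in Ioi (0 : ℝ), hausdorffContent ((d : ℝ) - α) {x | t < |u x|}
          ≤ (C : ℝ≥0∞) * ∫⁻ x, ‖G x‖ₑ) := by
  obtain ⟨n, rfl⟩ : ∃ n, d = n + 1 := ⟨d - 1, by omega⟩
  have hA : 0 < hyperplaneConst n α := hyperplaneConst_pos hα1
  constructor
  · rintro C' hC' ⟨C, hC⟩
    have hc : 0 < C' / hyperplaneConst n α := div_pos hC' hA
    refine not_exists_lintegral_hyperplaneMeasure_le n hα0 hα1 hc (T := C) ENNReal.coe_ne_top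
      fun u G hu hG hGi => hC u G _ hu.continuous (hu.memLp hq1) hG hGi
        (regular_hyperplaneMeasure hα0 hα1 hc) fun x r hr => ?_
    refine (hyperplaneMeasure_ball_le hα0 hα1 hc x hr).trans_eq ?_
    rw [div_mul_cancel₀ _ hA.ne']
  · rintro ⟨C, hC⟩
    have hs : 0 < ((n + 1 : ℕ) : ℝ) - α := by push_cast; linarith [n.cast_nonneg (α := ℝ)]
    have := regular_hyperplaneMeasure (n := n) hα0 hα1 one_pos
    set k : ℝ≥0∞ := ENNReal.ofReal (Real.pi ^ ((((n + 1 : ℕ) : ℝ) - α) / 2) /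
      Real.Gamma ((((n + 1 : ℕ) : ℝ) - α) / 2 + 1) / hyperplaneConst n α) with hk
    have hk0 : k ≠ 0 := by
      have hΓ := Real.Gamma_pos_of_pos (by linarith : 0 < (((n + 1 : ℕ) : ℝ) - α) / 2 + 1)
      rw [hk, Ne, ENNReal.ofReal_eq_zero, not_le]
      positivity
    refine not_exists_lintegral_hyperplaneMeasure_le n hα0 hα1 one_pos (T := C / k)
      (ENNReal.div_ne_top ENNReal.coe_ne_top hk0) fun u G hu hG hGi => ?_
    have hlayer : ∫⁻ x, ‖u x‖ₑ ∂hyperplaneMeasure n α 1 =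
        ∫⁻ t in Ioi (0 : ℝ), hyperplaneMeasure n α 1 {x | t < |u x|} := by
      simp only [Real.enorm_eq_ofReal_abs]
      exact lintegral_eq_lintegral_meas_lt _ (Filter.Eventually.of_forall fun x => abs_nonneg _)
        hu.continuous.abs.measurable.aemeasurable
    have h1 : k * ∫⁻ x, ‖u x‖ₑ ∂hyperplaneMeasure n α 1 ≤ C * ∫⁻ x, ‖G x‖ₑ := by
      refine le_trans ?_ (hC u G hu.continuous (hu.memLp hq1) hG hGi)
      rw [hlayer, ← lintegral_const_mul' _ _ ENNReal.ofReal_ne_top]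
      refine lintegral_mono fun t => mul_measure_le_hausdorffContent hs hA (fun x r hr => ?_) _
      simpa only [one_mul] using hyperplaneMeasure_ball_le hα0 hα1 one_pos x hr
    rw [← ENNReal.mul_div_right_comm, ENNReal.le_div_iff_mul_le (Or.inl hk0)
      (Or.inl ENNReal.ofReal_ne_top), mul_comm]
    exact h1
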